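/- Let $S^1=\mathbb R/\mathbb Z$. Fix a regularity class, either $C^k$ with $k\in\{1,2,\dots,\infty\}$ or Sobolev $W^{k,p}$ with $k\in\{1,2,\dots\}$, $1\le p<\infty$. Let $L\mathbb C=C^k(S^1)$, resp. $W^{k,p}(S^1)$, and $L^-\mathbb C=C^{k-1}(S^1)$, resp. $W^{k-1,p}(S^1)$ (complex valued functions, with their usual Banach or Fréchet topologies; $\infty-1=\infty$, $W^{0,p}=L^p$). Let $\mathfrak F$ be the space of holomorphic functions $F\colon\mathbb C\times L\mathbb C\to\mathbb C$ (that is, $F$ is continuous and holomorphic along each complex line) such that, for all $\zeta\in\mathbb C$ and $x,y\in L\mathbb C$, 1. $F(\zeta/\lambda,\lambda^2y)=O(\lambda^2)$ as $\mathbb C\ni\lambda\to0$; 2. $F(\zeta,x+y)=F(\zeta,x)+F(\zeta,y)$ if $\operatorname{supp}x\cap\operatorname{supp}y=\emptyset$; 3. $F(\zeta,y+c)=F(\zeta,y)$ for every constant $c\in\mathbb C$; $\mathfrak F$ carries the compact-open topology. Let $\mathfrak F^0\subset\mathfrak F$ be the subspace of those $F$ with $F(\zeta,cy)=cF(\zeta,y)$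 for all $c,\zeta\in\mathbb C$, $y\in L\mathbb C$. Let $(L^-\mathbb C)^*$ be the space of continuous linear forms on $L^-\mathbb C$ with the compact-open topology, and let $\mathbb C\subset(L^-\mathbb C)^*$ stand for the (one-dimensional) subspace of the forms $x\mapsto c\int_{S^1}x$, $c\in\mathbb C$. **Theorem.** $\mathfrak F^0$ consists exactly of those $F\in\mathfrak F$ that are fixed by the action $(gF)(\zeta,y)=F(g\zeta,y/J_g(\zeta))\,J_g(\zeta)$, $J_g(\zeta)=dg\zeta/d\zeta$, of the group $PSL(2,\mathbb C)$ of Möbius transformations $g$ (the equality $gF=F$ being required wherever $g\zeta\neq\infty$). The map that sends the class of $\Phi\in(L^-\mathbb C)^*$ to the function $F(\zeta,y)=\langle\Phi,\dot y\rangle$ is well defined and is an isomorphism of topological vector spaces $$(L^-\mathbb C)^*/\mathbb C\;\approx\;\mathfrak F^0 .$$ If $L^-\mathbb C$ is interpreted as the space of one-forms $x(t)\,dt$ on $S^1$ of the corresponding regularity, then this isomorphism is equivariant under $\operatorname{Diff}S^1$, the group of $C^k$ diffeomorphisms of $S^1$: for each $\varphi\in\operatorname{Diff}S^1$ the pullbacks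 $\varphi^*y=y\circ\varphi$ and $\varphi^*(x\,dt)=(x\circ\varphi)\,\varphi'\,dt$ are continuous linear operators on $L\mathbb C$ and on $L^-\mathbb C$, and if the class of $\Phi$ corresponds to $F$, then the class of $\Phi\circ\varphi^*$ corresponds to the function $(\zeta,y)\mapsto F(\zeta,\varphi^*y)$. -/

import Mathlib

open MeasureTheory Filter Topology Asymptotics
open scoped ENNReal CompactConvergenceCLM

noncomputable section

namespace LoopSpace

/-! ### Functions on the circle `S¹ = ℝ / ℤ` -/

/-- The circle `ℝ / ℤ`, with its Lebesgue measure `volume` of total mass one. -/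
abbrev S1 : Type := UnitAddCircle

/-- `f : S¹ → ℂ` is of class `C^l`, `l = 0, 1, …, ∞`: its `1`-periodic lift to `ℝ` is. -/
def IsCk (l : ℕ∞) (f : S1 → ℂ) : Prop :=
  ContDiff ℝ (l : WithTop ℕ∞) (fun s : ℝ => f (s : S1))

/-- The derivative `ḟ = df/dt` of a function on the circle. -/
def circleDeriv (f : S1 → ℂ) (t : S1) : ℂ :=
  deriv (fun s : ℝ => f (t + (s : S1))) 0

lemma circleDeriv_coe (f : S1 → ℂ) :
    (fun s : ℝ => circleDeriv f (s : S1)) = deriv (fun s : ℝ => f (s : S1)) := by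
  funext s
  have h := deriv_comp_const_add (fun u : ℝ => f (u : S1)) s 0
  simpa [circleDeriv, AddCircle.coe_add] using h

lemma circleDeriv_iterate_coe (f : S1 → ℂ) (j : ℕ) :
    (fun s : ℝ => (circleDeriv^[j] f) (s : S1)) = iteratedDeriv j (fun s : ℝ => f (s : S1)) := by
  induction j with
  | zero => simp
  | succ j ih => rw [Function.iterate_succ_apply', circleDeriv_coe, ih, iteratedDeriv_succ]

lemma continuous_of_coe {f : S1 → ℂ} (h : Continuous (fun s : ℝ => f (s : S1))) :
    Continuous f :=
  continuous_coinduced_dom.mpr h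

lemma IsCk.continuous_iterate {l : ℕ∞} {f : S1 → ℂ} (hf : IsCk l f) {j : ℕ}
    (hj : (j : ℕ∞) ≤ l) : Continuous (circleDeriv^[j] f) := by
  apply continuous_of_coe
  rw [circleDeriv_iterate_coe]
  exact ContDiff.continuous_iteratedDeriv j hf (by exact_mod_cast hj)

lemma IsCk.circleDeriv {l : ℕ∞} {f : S1 → ℂ} (hf : IsCk (l + 1) f) :
    IsCk l (circleDeriv f) := by
  have hf' : ContDiff ℝ ((l : WithTop ℕ∞) + 1) (fun s : ℝ => f (s : S1)) := by
    have h := hf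
    unfold IsCk at h
    exact_mod_cast h
  unfold IsCk
  rw [circleDeriv_coe]
  exact (contDiff_succ_iff_deriv.mp hf').2.2

/-! ### The spaces `C^l(S¹)` -/

def ckSubmodule (l : ℕ∞) : Submodule ℂ (S1 → ℂ) where
  carrier := {f | IsCk l f}
  add_mem' {f g} hf hg := show ContDiff ℝ _ (fun s : ℝ => f (s : S1) + g (s : S1)) from
    ContDiff.add (show IsCk l f from hf) (show IsCk l g from hg)
  zero_mem' := show IsCk l 0 from
    (contDiff_const : ContDiff ℝ (l : WithTop ℕ∞) (fun _ : ℝ => (0 : ℂ)))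
  smul_mem' c f hf := show ContDiff ℝ _ (fun s : ℝ => c • f (s : S1)) from
    ContDiff.const_smul c (show IsCk l f from hf)

/-- `C^l(S¹)`, `l = 0, 1, …, ∞`. -/
def Ck (l : ℕ∞) : Type := ↥(ckSubmodule l)

instance (l : ℕ∞) : AddCommGroup (Ck l) := inferInstanceAs (AddCommGroup ↥(ckSubmodule l))
instance (l : ℕ∞) : Module ℂ (Ck l) := inferInstanceAs (Module ℂ ↥(ckSubmodule l))

/-- The underlying function of an element of `C^l(S¹)`. -/
def Ck.fn {l : ℕ∞} (f : Ck l) : S1 → ℂ := f.1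

/-- The `j`-th derivative, `j ≤ l`, of an element of `C^l(S¹)`, as a continuous function. -/
def Ck.iterDeriv {l : ℕ∞} (f : Ck l) (j : ℕ) (hj : (j : ℕ∞) ≤ l) : C(S1, ℂ) :=
  ⟨circleDeriv^[j] f.fn, IsCk.continuous_iterate (show IsCk l f.fn from f.2) hj⟩

/-- The Banach (`l < ∞`) or Fréchet (`l = ∞`) topology of `C^l(S¹)`: uniform convergence of each
derivative of order at most `l`. -/
instance (l : ℕ∞) : TopologicalSpace (Ck l) :=
  TopologicalSpace.induced
    (fun f (j : {j : ℕ // (j : ℕ∞) ≤ l}) => f.iterDeriv j.1 j.2) inferInstance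

/-- `y ↦ ẏ`, `C^{l+1}(S¹) → C^l(S¹)`. -/
def Ck.dot {l : ℕ∞} (y : Ck (l + 1)) : Ck l :=
  ⟨circleDeriv y.fn, IsCk.circleDeriv (show IsCk (l + 1) y.fn from y.2)⟩

/-! ### The Sobolev spaces `W^{l,p}(S¹)` -/

/-- `v` is the weak derivative of `u`, both in `L^p(S¹)`. -/
def HasWeakDeriv {p : ℝ≥0∞} (u v : Lp ℂ p (volume : Measure S1)) : Prop :=
  ∀ φ : S1 → ℂ, IsCk ⊤ φ → ∫ t, u t * circleDeriv φ t = - ∫ t, v t * φ t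

lemma integrable_mul_of_continuous {p : ℝ≥0∞} [Fact (1 ≤ p)]
    (u : Lp ℂ p (volume : Measure S1)) {φ : S1 → ℂ} (hφ : Continuous φ) :
    Integrable (fun t => u t * φ t) (volume : Measure S1) := by
  have hu : Integrable (fun t => u t) (volume : Measure S1) := (Lp.memLp u).integrable Fact.out
  obtain ⟨C, hC⟩ := isCompact_univ.exists_bound_of_continuousOn hφ.continuousOn
  exact hu.mul_bdd (c := C) hφ.aestronglyMeasurable (ae_of_all _ fun t => hC t trivial)

lemma IsCk.continuous {l : ℕ∞} {f : S1 → ℂ} (hf : IsCk l f) : Continuous f :=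
  continuous_of_coe (ContDiff.continuous hf)

lemma IsCk.continuous_circleDeriv {f : S1 → ℂ} (hf : IsCk ⊤ f) :
    Continuous (LoopSpace.circleDeriv f) :=
  IsCk.continuous_iterate (j := 1) hf le_top

lemma HasWeakDeriv.add {p : ℝ≥0∞} [Fact (1 ≤ p)] {u v u' v' : Lp ℂ p (volume : Measure S1)}
    (h : HasWeakDeriv u v) (h' : HasWeakDeriv u' v') : HasWeakDeriv (u + u') (v + v') := by
  intro φ hφ
  have e1 : ∫ t, (u + u') t * circleDeriv φ t
      = ∫ t, (u t * circleDeriv φ t + u' t * circleDeriv φ t) := by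
    apply integral_congr_ae
    filter_upwards [Lp.coeFn_add u u'] with t ht
    rw [ht, Pi.add_apply, add_mul]
  have e2 : ∫ t, (v + v') t * φ t = ∫ t, (v t * φ t + v' t * φ t) := by
    apply integral_congr_ae
    filter_upwards [Lp.coeFn_add v v'] with t ht
    rw [ht, Pi.add_apply, add_mul]
  rw [e1, e2, integral_add (integrable_mul_of_continuous u hφ.continuous_circleDeriv)
    (integrable_mul_of_continuous u' hφ.continuous_circleDeriv),
    integral_add (integrable_mul_of_continuous v hφ.continuous)
    (integrable_mul_of_continuous v' hφ.continuous), h φ hφ, h' φ hφ]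
  ring

lemma HasWeakDeriv.smul {p : ℝ≥0∞} {u v : Lp ℂ p (volume : Measure S1)} (c : ℂ)
    (h : HasWeakDeriv u v) : HasWeakDeriv (c • u) (c • v) := by
  intro φ hφ
  have e1 : ∫ t, (c • u) t * circleDeriv φ t = ∫ t, c * (u t * circleDeriv φ t) := by
    apply integral_congr_ae
    filter_upwards [Lp.coeFn_smul c u] with t ht
    rw [ht, Pi.smul_apply, smul_eq_mul, mul_assoc]
  have e2 : ∫ t, (c • v) t * φ t = ∫ t, c * (v t * φ t) := by
    apply integral_congr_ae
    filter_upwards [Lp.coeFn_smul c v] with t ht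
    rw [ht, Pi.smul_apply, smul_eq_mul, mul_assoc]
  rw [e1, e2, integral_const_mul, integral_const_mul, h φ hφ]
  ring

/-- `w 0, …, w l` are `u` and its weak derivatives of order at most `l`, all in `L^p(S¹)`. -/
def IsWeakJet {p : ℝ≥0∞} (l : ℕ) (u : Lp ℂ p (volume : Measure S1))
    (w : ℕ → Lp ℂ p (volume : Measure S1)) : Prop :=
  w 0 = u ∧ ∀ j < l, HasWeakDeriv (w j) (w (j + 1))

def sobolevSubmodule (l : ℕ) (p : ℝ≥0∞) [Fact (1 ≤ p)] :
    Submodule ℂ (Lp ℂ p (volume : Measure S1)) where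
  carrier := {u | ∃ w, IsWeakJet l u w}
  add_mem' := by
    rintro u u' ⟨w, hw0, hw⟩ ⟨w', hw0', hw'⟩
    exact ⟨w + w', by simp [hw0, hw0'], fun j hj => (hw j hj).add (hw' j hj)⟩
  zero_mem' := by
    refine ⟨0, rfl, fun j _ φ _ => ?_⟩
    have h0 : ∀ ψ : S1 → ℂ,
        ∫ t, (0 : Lp ℂ p (volume : Measure S1)) t * ψ t = 0 := by
      intro ψ
      apply integral_eq_zero_of_ae
      filter_upwards [Lp.coeFn_zero ℂ p (volume : Measure S1)] with t ht
      have h1 : (0 : Lp ℂ p (volume : Measure S1)) t = 0 := ht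
      rw [h1, zero_mul, Pi.zero_apply]
    exact (h0 _).trans (neg_eq_zero.mpr (h0 φ)).symm
  smul_mem' := by
    rintro c u ⟨w, hw0, hw⟩
    exact ⟨c • w, by simp [hw0], fun j hj => (hw j hj).smul c⟩

/-- `W^{l,p}(S¹)`: the `L^p` functions with weak derivatives of order at most `l` in `L^p`;
`W^{0,p}(S¹) = L^p(S¹)`. -/
def Sob (l : ℕ) (p : ℝ≥0∞) [Fact (1 ≤ p)] : Type := ↥(sobolevSubmodule l p)

section Sob

variable {l : ℕ} {p : ℝ≥0∞} [Fact (1 ≤ p)]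

instance : AddCommGroup (Sob l p) := inferInstanceAs (AddCommGroup ↥(sobolevSubmodule l p))
instance : Module ℂ (Sob l p) := inferInstanceAs (Module ℂ ↥(sobolevSubmodule l p))

/-- A function representing an element of `W^{l,p}(S¹)`, determined up to null sets. -/
def Sob.fn (u : Sob l p) : S1 → ℂ := (u.1 : S1 → ℂ)

/-- The weak derivatives of `u ∈ W^{l,p}(S¹)`; as weak derivatives are unique, only the values at
`j > l` depend on a choice. -/
def Sob.weakDeriv (u : Sob l p) : ℕ → Lp ℂ p (volume : Measure S1) :=
  Classical.choose u.2

lemma Sob.weakDeriv_spec (u : Sob l p) : IsWeakJet l u.1 u.weakDeriv :=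
  Classical.choose_spec u.2

/-- The Banach space topology of `W^{l,p}(S¹)`: `L^p` convergence of all weak derivatives of order
at most `l`. -/
instance : TopologicalSpace (Sob l p) :=
  TopologicalSpace.induced (fun u (j : Fin (l + 1)) => u.weakDeriv j) inferInstance

/-- `y ↦ ẏ`, `W^{l+1,p}(S¹) → W^{l,p}(S¹)`. -/
def Sob.dot (y : Sob (l + 1) p) : Sob l p :=
  ⟨y.weakDeriv 1, fun j => y.weakDeriv (j + 1), rfl,
    fun j hj => y.weakDeriv_spec.2 (j + 1) (by omega)⟩

end Sob

/-! ### The space `𝔉` and its subspaces -/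

/-- The support of a function on the circle given up to null sets: the complement of the largest
open set on which it vanishes almost everywhere. For a continuous function this is the closure of
the set where it does not vanish. -/
def circleSupp (f : S1 → ℂ) : Set S1 :=
  {t | ∀ U ∈ 𝓝 t, ¬ ∀ᵐ s ∂(volume : Measure S1), s ∈ U → f s = 0}

section FSpace

/- `V` is one of the spaces of functions on the circle defined above, and `ρ y` is the function
that represents `y ∈ V`. -/
variable {V : Type} [AddCommGroup V] [Module ℂ V] [TopologicalSpace V]

/-- A continuous function on `ℂ × V` is holomorphic if it is holomorphic along each complex
line. -/
def IsHolomorphic (F : C(ℂ × V, ℂ)) : Prop :=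
  ∀ a b : ℂ × V, Differentiable ℂ (fun z : ℂ => F (a + z • b))

/-- The space `𝔉` of holomorphic functions on `ℂ × V` with the three defining properties. As a
subspace of `C(ℂ × V, ℂ)` it carries the compact-open topology. -/
def FSpace (ρ : V → S1 → ℂ) : Submodule ℂ C(ℂ × V, ℂ) where
  carrier := {F | IsHolomorphic F ∧
    (∀ (ζ : ℂ) (y : V),
      (fun z : ℂ => F (ζ / z, z ^ 2 • y)) =O[𝓝[≠] (0 : ℂ)] (fun z : ℂ => z ^ 2)) ∧
    (∀ (ζ : ℂ) (x y : V), circleSupp (ρ x) ∩ circleSupp (ρ y) = ∅ →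
      F (ζ, x + y) = F (ζ, x) + F (ζ, y)) ∧
    (∀ (ζ : ℂ) (y e : V), (∃ c : ℂ, ∀ᵐ t ∂(volume : Measure S1), ρ e t = c) →
      F (ζ, y + e) = F (ζ, y))}
  add_mem' := by
    rintro F G ⟨hF, hF1, hF2, hF3⟩ ⟨hG, hG1, hG2, hG3⟩
    refine ⟨fun a b => (hF a b).add (hG a b), fun ζ y => (hF1 ζ y).add (hG1 ζ y), ?_, ?_⟩
    · intro ζ x y h
      simp only [ContinuousMap.add_apply, hF2 ζ x y h, hG2 ζ x y h]
      ring
    · intro ζ y e h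
      simp only [ContinuousMap.add_apply, hF3 ζ y e h, hG3 ζ y e h]
  zero_mem' := by
    refine ⟨fun a b => differentiable_const 0, fun ζ y => isBigO_zero _ _, ?_, ?_⟩
    · intro ζ x y _
      simp
    · intro ζ y e _
      simp
  smul_mem' := by
    rintro c F ⟨hF, hF1, hF2, hF3⟩
    refine ⟨fun a b => (hF a b).const_smul c, fun ζ y => (hF1 ζ y).const_smul_left c, ?_, ?_⟩
    · intro ζ x y h
      simp only [ContinuousMap.smul_apply, hF2 ζ x y h, smul_add]
    · intro ζ y e h
      simp only [ContinuousMap.smul_apply, hF3 ζ y e h]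

/-- `𝔉ⁿ ⊆ 𝔉`: the posthomogeneous functions of degree `n + 1`. -/
def FHom (ρ : V → S1 → ℂ) (n : ℕ) : Submodule ℂ C(ℂ × V, ℂ) where
  carrier := {F | F ∈ FSpace ρ ∧ ∀ (ζ c : ℂ) (y : V), F (ζ, c • y) = c ^ (n + 1) * F (ζ, y)}
  add_mem' := by
    rintro F G ⟨hF, hF'⟩ ⟨hG, hG'⟩
    refine ⟨add_mem hF hG, fun ζ c y => ?_⟩
    simp only [ContinuousMap.add_apply, hF', hG']
    ring
  zero_mem' := ⟨zero_mem _, fun ζ c y => by simp⟩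
  smul_mem' := by
    rintro a F ⟨hF, hF'⟩
    refine ⟨Submodule.smul_mem _ a hF, fun ζ c y => ?_⟩
    simp only [ContinuousMap.smul_apply, hF', smul_eq_mul]
    ring

/-- `F` is fixed by the action `(gF)(ζ, y) = F(gζ, y / J_g(ζ)) J_g(ζ)` of `G = PSL(2, ℂ)`. Here
`gζ = (aζ + b)/(cζ + d)` with `ad - bc = 1`, so that `J_g(ζ) = dgζ/dζ = (cζ + d)⁻²`. -/
def IsGFixed (F : C(ℂ × V, ℂ)) : Prop :=
  ∀ g : Matrix.SpecialLinearGroup (Fin 2) ℂ, ∀ (ζ : ℂ) (y : V), g 1 0 * ζ + g 1 1 ≠ 0 →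
    F ((g 0 0 * ζ + g 0 1) / (g 1 0 * ζ + g 1 1), (g 1 0 * ζ + g 1 1) ^ 2 • y)
      * ((g 1 0 * ζ + g 1 1) ^ 2)⁻¹ = F (ζ, y)

/-- The multiples `x ↦ c ∫ x` of the integral in the dual `V^*`, which carries the compact-open
topology. -/
def integralLine (ρ : V → S1 → ℂ) : Submodule ℂ (V →L_c[ℂ] ℂ) where
  carrier := {Φ | ∃ c : ℂ, ∀ x : V, Φ x = c * ∫ t, ρ x t}
  add_mem' := by
    rintro Φ Ψ ⟨c, hc⟩ ⟨d, hd⟩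
    refine ⟨c + d, fun x => ?_⟩
    rw [add_mul, ← hc, ← hd]
    rfl
  zero_mem' := ⟨0, fun x => by rw [zero_mul]; rfl⟩
  smul_mem' := by
    rintro a Φ ⟨c, hc⟩
    refine ⟨a * c, fun x => ?_⟩
    rw [mul_assoc, ← hc]
    rfl

end FSpace

/-! ### Diffeomorphisms of the circle -/

/-- A homeomorphism of the circle that lifts to a `C^k` map `ℝ → ℝ`, and whose inverse does:
a `C^k` diffeomorphism, orientation preserving or not. -/
structure CircleDiffeo (k : ℕ∞) where
  toHomeomorph : S1 ≃ₜ S1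
  exists_lift : ∃ ψ : ℝ → ℝ, ContDiff ℝ (k : WithTop ℕ∞) ψ ∧
    ∀ s : ℝ, toHomeomorph (s : S1) = (ψ s : S1)
  exists_lift_symm : ∃ ψ : ℝ → ℝ, ContDiff ℝ (k : WithTop ℕ∞) ψ ∧
    ∀ s : ℝ, toHomeomorph.symm (s : S1) = (ψ s : S1)

/-- The derivative `φ'(t)` of a diffeomorphism `φ`: the derivative of a lift to `ℝ`, which depends
neither on the lift nor on the point of `ℝ` over `t`. -/
def CircleDiffeo.deriv {k : ℕ∞} (φ : CircleDiffeo k) (t : S1) : ℝ :=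
  _root_.deriv (Classical.choose φ.exists_lift) (AddCircle.equivIco 1 0 t : ℝ)

/-- `A` is the pullback of functions, `φ^* y = y ∘ φ`. -/
def IsFunctionPullback {k : ℕ∞} (φ : CircleDiffeo k) {V : Type} (ρ : V → S1 → ℂ)
    (A : V → V) : Prop :=
  ∀ y : V, ∀ᵐ t ∂(volume : Measure S1), ρ (A y) t = ρ y (φ.toHomeomorph t)

/-- `B` is the pullback of one-forms, `φ^* (x(t) dt) = x(φ(t)) φ'(t) dt`. -/
def IsFormPullback {k : ℕ∞} (φ : CircleDiffeo k) {V : Type} (ρ : V → S1 → ℂ)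
    (B : V → V) : Prop :=
  ∀ x : V, ∀ᵐ t ∂(volume : Measure S1),
    ρ (B x) t = ρ x (φ.toHomeomorph t) * (φ.deriv t : ℂ)

end LoopSpace

end

noncomputable section

namespace LoopSpace

/-! ### Homogeneous holomorphic functions -/

section Homogeneous

variable {V : Type} [AddCommGroup V] [Module ℂ V]

/-! Degree one homogeneity turns holomorphy into linearity. Writing F(ζ, x + zy) = z F(ζ, y + x/z)
shows that F grows at most linearly along each line, so Liouville's theorem makes it additive in the
loop (`map_add_of_homogeneous`). The growth condition with λ = 1/z bounds z ↦ F(zζ, y), so ζ drops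
out (`FHom.apply_eq_apply_zero`). Hence 𝔉⁰ consists of the continuous linear forms on loops that
vanish on constants; for these, additivity on disjoint supports is automatic. Translations and
diagonal matrices suffice to recover both properties from Möbius invariance.

Let D be differentiation and P x the primitive of x - ∫ x. Then D P is the identity minus the mean,
and P D is the identity modulo constants. So Φ ↦ Φ ∘ D kills exactly the multiples of the integral,
and F ↦ F(0, P ·) inverts it on the quotient. Both maps are continuous because D and P carry compact
sets to compact sets (`exists_equiv_FHom`); no open mapping theorem enters. Equivariance is the
chain rule D(y ∘ φ) = (Dy ∘ φ) φ'.

The two regularity scales are handled together by `CircleModel`: a base space, C⁰ or L^p, with a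
bounded primitive, in which derivatives are defined by integrating. `Realizes` describes C^l and
W^{l,p}, with their topologies, through continuous families of jets. In L^p the required identities
follow from those for continuous functions, by density (p < ∞) and closedness of the weak
derivative; pullbacks are bounded there by `exists_map_volume_le`. -/

/-- An entire function whose difference quotient at the origin tends to `c` at infinity is
affine with slope `c`. -/
lemma sub_eq_of_tendsto_slope {g : ℂ → ℂ} (hg : Differentiable ℂ g) {c : ℂ}
    (h : Tendsto (fun z => z⁻¹ * (g z - g 0)) (cocompact ℂ) (𝓝 c)) : g 1 - g 0 = c := by
  -- The divided difference extends over the origin to an entire function; having a limit at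
  -- infinity, it is constant by Liouville.
  have hd : Differentiable ℂ (dslope g 0) := by
    have := (Complex.differentiableOn_dslope (s := Set.univ) (c := (0 : ℂ)) (f := g)
      Filter.univ_mem).mpr hg.differentiableOn
    exact differentiableOn_univ.mp this
  have hne : ∀ᶠ z : ℂ in cocompact ℂ, z ≠ 0 := by
    have := (isCompact_singleton (x := (0 : ℂ))).compl_mem_cocompact
    filter_upwards [this] with z hz using hz
  have ht : Tendsto (dslope g 0) (cocompact ℂ) (𝓝 c) := by
    refine h.congr' ?_
    filter_upwards [hne] with z hz
    rw [dslope_of_ne _ hz, slope_def_field]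
    simp only [sub_zero]
    field_simp
  have := hd.apply_eq_of_tendsto_cocompact 1 ht
  rw [dslope_of_ne _ one_ne_zero, slope_def_field] at this
  simpa using this

/-- By homogeneity f(x + zy)/z = f(y + x/z), which tends to f(y) as z → ∞, so z ↦ f(x + zy) is
affine with slope f(y). Holomorphy along lines is enough; no topology on `V` is involved. -/
lemma map_add_of_homogeneous {f : V → ℂ}
    (hol : ∀ x y : V, Differentiable ℂ (fun z : ℂ => f (x + z • y)))
    (hom : ∀ (c : ℂ) (y : V), f (c • y) = c * f y) (x y : V) : f (x + y) = f x + f y := by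
  have key := sub_eq_of_tendsto_slope (c := f y) (hol x y) ?_
  · simp only [one_smul, zero_smul, add_zero] at key
    linear_combination key
  have hne : ∀ᶠ z : ℂ in cocompact ℂ, z ≠ 0 := by
    have := (isCompact_singleton (x := (0 : ℂ))).compl_mem_cocompact
    filter_upwards [this] with z hz using hz
  have hinv : Tendsto (fun z : ℂ => z⁻¹) (cocompact ℂ) (𝓝 0) := by
    rw [← Metric.cobounded_eq_cocompact]
    exact tendsto_inv₀_cobounded
  have h1 : Tendsto (fun z : ℂ => f (y + z⁻¹ • x)) (cocompact ℂ) (𝓝 (f y)) := by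
    have := ((hol y x).continuous.tendsto 0).comp hinv
    simpa [Function.comp_def] using this
  have h2 : Tendsto (fun z : ℂ => f (y + z⁻¹ • x) - z⁻¹ * f x) (cocompact ℂ) (𝓝 (f y)) := by
    simpa using h1.sub (hinv.mul_const (f x))
  refine h2.congr' ?_
  filter_upwards [hne] with z hz
  have : x + z • y = z • (y + z⁻¹ • x) := by
    rw [smul_add, smul_smul, mul_inv_cancel₀ hz, one_smul, add_comm]
  simp only [this, hom, zero_smul, add_zero]
  field_simp

end Homogeneous

/-! ### Posthomogeneous functions of degree one and Möbius invariance -/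

section FSpaceLemmas

variable {V : Type} [AddCommGroup V] [Module ℂ V] [TopologicalSpace V] {ρ : V → S1 → ℂ}

/-- Substituting λ = 1/z in the growth condition gives F(zζ, z⁻²y) = O(z⁻²). Homogeneity cancels the
factor z⁻², so z ↦ F(zζ, y) is bounded near infinity and its slope there is zero. -/
lemma FHom.apply_eq_apply_zero {F : C(ℂ × V, ℂ)} (hF : F ∈ FHom ρ 0) (ζ : ℂ) (y : V) :
    F (ζ, y) = F (0, y) := by
  obtain ⟨⟨hol, hgrowth, -, -⟩, hom⟩ := hF
  have hg : Differentiable ℂ (fun z : ℂ => F (z * ζ, y)) := by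
    simpa [Prod.smul_mk, smul_eq_mul] using hol (0, y) (ζ, 0)
  have key := sub_eq_of_tendsto_slope (c := 0) hg ?_
  · simp only [one_mul, zero_mul] at key
    linear_combination key
  have hinv : Tendsto (fun z : ℂ => z⁻¹) (cocompact ℂ) (𝓝 0) := by
    rw [← Metric.cobounded_eq_cocompact]
    exact tendsto_inv₀_cobounded
  have hne : ∀ᶠ z : ℂ in cocompact ℂ, z ≠ 0 := by
    have := (isCompact_singleton (x := (0 : ℂ))).compl_mem_cocompact
    filter_upwards [this] with z hz using hz
  have hinv' : Tendsto (fun z : ℂ => z⁻¹) (cocompact ℂ) (𝓝[≠] 0) :=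
    tendsto_nhdsWithin_iff.mpr ⟨hinv, hne.mono fun z hz => inv_ne_zero hz⟩
  have hb : (fun z : ℂ => F (z * ζ, y)) =O[cocompact ℂ] (fun _ => (1 : ℂ)) := by
    have h := (hgrowth ζ y).comp_tendsto hinv'
    have h' := (isBigO_refl (fun z : ℂ => z ^ 2) (cocompact ℂ)).mul h
    refine h'.congr' ?_ ?_
    · filter_upwards [hne] with z hz
      simp only [Function.comp_def, hom, div_inv_eq_mul, zero_add, pow_one]
      rw [mul_comm ζ z]
      field_simp
    · filter_upwards [hne] with z hz
      simp only [Function.comp_def]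
      field_simp
  have hb' : (fun z : ℂ => F (z * ζ, y) - F (0 * ζ, y)) =O[cocompact ℂ] (fun _ => (1 : ℂ)) :=
    hb.sub (isBigO_const_const _ one_ne_zero _)
  have := (isBigO_refl (fun z : ℂ => z⁻¹) (cocompact ℂ)).mul hb'
  exact this.trans_tendsto (by simpa using hinv)

/-- A posthomogeneous function of degree one in `𝔉` is linear in the second variable. -/
def FHom.toLinearMap (F : FHom ρ 0) : V →L[ℂ] ℂ where
  toFun y := F.1 (0, y)
  map_add' x y := by
    refine map_add_of_homogeneous (f := fun y => F.1 (0, y)) (fun x y => ?_) (fun c y => ?_) x y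
    · simpa [Prod.smul_mk] using F.2.1.1 (0, x) (0, y)
    · simpa using F.2.2 0 c y
  map_smul' c y := by simpa using F.2.2 0 c y
  cont := F.1.continuous.comp (by fun_prop)

/-- For the converse, translations remove the dependence on ζ, and diag(a⁻¹, a), which fixes 0,
gives homogeneity under a². Every nonzero complex number is such a square. -/
lemma mem_FHom_zero_iff_isGFixed {F : C(ℂ × V, ℂ)} (hF : F ∈ FSpace ρ) :
    F ∈ FHom ρ 0 ↔ IsGFixed F := by
  constructor
  · intro h g ζ y hne
    rw [h.2, FHom.apply_eq_apply_zero h, FHom.apply_eq_apply_zero h ζ]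
    field_simp
    simp
  · intro h
    have htrans : ∀ (ζ : ℂ) (y : V), F (ζ, y) = F (0, y) := by
      intro ζ y
      have := h ⟨!![1, ζ; 0, 1], by simp [Matrix.det_fin_two]⟩ 0 y (by simp)
      simpa using this
    have hne : ∀ (c : ℂ) (y : V), c ≠ 0 → F (0, c • y) = c * F (0, y) := by
      intro c y hc
      obtain ⟨a, rfl⟩ : ∃ a : ℂ, c = a ^ 2 := ⟨c ^ (1 / 2 : ℂ), by
        rw [← Complex.cpow_nat_mul]; simp⟩
      have ha : a ≠ 0 := by rintro rfl; simp at hc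
      have := h ⟨!![a⁻¹, 0; 0, a], by simp [Matrix.det_fin_two, ha]⟩ 0 y (by simpa using ha)
      simp at this
      rw [← this]
      field_simp
    refine ⟨hF, fun ζ c y => ?_⟩
    rw [htrans, htrans ζ y, zero_add, pow_one]
    rcases eq_or_ne c 0 with rfl | hc
    · have h0 := hne 2 0 two_ne_zero
      rw [smul_zero] at h0
      rw [zero_smul, zero_mul]
      linear_combination -h0
    · exact hne c y hc

/-! ### The isomorphism, from an abstract derivative and primitive -/

variable {W : Type} [AddCommGroup W] [Module ℂ W] [TopologicalSpace W] {σ : W → S1 → ℂ}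

lemma finrank_integralLine {J : W →L[ℂ] ℂ} (hJ : ∀ x, J x = ∫ t, σ x t) {one : W}
    (hone : J one = 1) : Module.finrank ℂ (integralLine σ) = 1 := by
  refine finrank_eq_one (⟨J, 1, fun x => ?_⟩ : integralLine σ) ?_ ?_
  · rw [one_mul, ← hJ]
    rfl
  · intro h
    have h1 : J = 0 := congrArg Subtype.val h
    rw [h1] at hone
    simp at hone
  · rintro ⟨Φ, c, hc⟩
    refine ⟨c, Subtype.ext (UniformConvergenceCLM.ext _ _ fun x => ?_)⟩
    rw [hc, ← hJ]
    rfl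

/-- The function `(ζ, y) ↦ Φ (D y)`. -/
def pairing (D : V →L[ℂ] W) (Φ : W →L_c[ℂ] ℂ) : C(ℂ × V, ℂ) :=
  ⟨fun q => Φ (D q.2), (map_continuous Φ).comp (D.continuous.comp continuous_snd)⟩

@[simp] lemma pairing_apply (D : V →L[ℂ] W) (Φ : W →L_c[ℂ] ℂ) (ζ : ℂ) (y : V) :
    pairing D Φ (ζ, y) = Φ (D y) := rfl

lemma pairing_mem_FHom {D : V →L[ℂ] W}
    (hD : ∀ e : V, (∃ c : ℂ, ∀ᵐ t ∂(volume : Measure S1), ρ e t = c) → D e = 0)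
    (Φ : W →L_c[ℂ] ℂ) : pairing D Φ ∈ FHom ρ 0 := by
  refine ⟨⟨fun a b => ?_, fun ζ y => ?_, fun ζ x y _ => ?_, fun ζ y e he => ?_⟩, fun ζ c y => ?_⟩
  · have : (fun z : ℂ => pairing D Φ (a + z • b)) = fun z => Φ (D a.2) + z * Φ (D b.2) := by
      funext z
      show Φ (D (a.2 + z • b.2)) = _
      simp
    rw [this]
    fun_prop
  · simp only [pairing_apply, map_smul, smul_eq_mul]
    simpa using (isBigO_refl (fun z : ℂ => z ^ 2) (𝓝[≠] 0)).mul
      (isBigO_const_const (Φ (D y)) (one_ne_zero (α := ℂ)) (𝓝[≠] (0 : ℂ)))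
  · simp
  · simp [hD e he]
  · simp

def pairingLinear (D : V →L[ℂ] W)
    (hD : ∀ e : V, (∃ c : ℂ, ∀ᵐ t ∂(volume : Measure S1), ρ e t = c) → D e = 0) :
    (W →L_c[ℂ] ℂ) →ₗ[ℂ] FHom ρ 0 where
  toFun Φ := ⟨pairing D Φ, pairing_mem_FHom hD Φ⟩
  map_add' _ _ := rfl
  map_smul' _ _ := rfl

/-- Uniform convergence of forms on the compact image of `K` under (ζ, y) ↦ D y is uniform
convergence on `K` of the associated functions. -/
lemma continuous_pairingLinear (D : V →L[ℂ] W)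
    (hD : ∀ e : V, (∃ c : ℂ, ∀ᵐ t ∂(volume : Measure S1), ρ e t = c) → D e = 0) :
    Continuous (pairingLinear D hD) := by
  refine Continuous.subtype_mk ?_ _
  refine continuous_iff_continuousAt.mpr fun Φ => ?_
  rw [ContinuousAt, ContinuousMap.tendsto_iff_forall_isCompact_tendstoUniformlyOn]
  intro K hK
  have h := (UniformConvergenceCLM.tendsto_iff_tendstoUniformlyOn (σ := RingHom.id ℂ)
    (𝔖 := {S : Set W | IsCompact S}) (a := id) (p := 𝓝 Φ) (a₀ := Φ)).mp tendsto_id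
    ((fun q : ℂ × V => D q.2) '' K) (hK.image (D.continuous.comp continuous_snd))
  exact (h.comp (fun q : ℂ × V => D q.2)).mono (Set.subset_preimage_image _ _)

/-- The candidate inverse: a form on derivatives is obtained by evaluating F on primitives. -/
def pullPrimitive (P : W →L[ℂ] V) : FHom ρ 0 →ₗ[ℂ] (W →L_c[ℂ] ℂ) where
  toFun F := (FHom.toLinearMap F).comp P
  map_add' _ _ := rfl
  map_smul' _ _ := rfl

lemma continuous_pullPrimitive (P : W →L[ℂ] V) :
    Continuous (pullPrimitive (ρ := ρ) P) := by
  refine continuous_iff_continuousAt.mpr fun F => ?_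
  rw [ContinuousAt, UniformConvergenceCLM.tendsto_iff_tendstoUniformlyOn]
  intro K hK
  have h := ContinuousMap.tendsto_iff_forall_isCompact_tendstoUniformlyOn.mp
    ((continuous_subtype_val (p := fun G => G ∈ FHom ρ 0)).tendsto F)
    ((fun x : W => ((0 : ℂ), P x)) '' K)
    (IsCompact.image hK (continuous_const.prodMk P.continuous))
  exact (h.comp (fun x : W => ((0 : ℂ), P x))).mono (Set.subset_preimage_image _ _)

/-- A continuous linear map `T` with a continuous right inverse `S`, such that `S ∘ T` is the
identity modulo `p ≤ ker T`, induces an isomorphism on the quotient by `p`. -/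
lemma exists_quotient_equiv {M N : Type*} [AddCommGroup M] [Module ℂ M] [TopologicalSpace M]
    [AddCommMonoid N] [Module ℂ N] [TopologicalSpace N] {p : Submodule ℂ M} {T : M →ₗ[ℂ] N}
    {S : N →ₗ[ℂ] M} (hT : Continuous T) (hS : Continuous S) (hker : ∀ m ∈ p, T m = 0)
    (hTS : ∀ n, T (S n) = n) (hST : ∀ m, S (T m) - m ∈ p) :
    ∃ e : (M ⧸ p) ≃L[ℂ] N, ∀ m, e (Submodule.Quotient.mk m) = T m := by
  let f : (M ⧸ p) →ₗ[ℂ] N :=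
    { QuotientAddGroup.lift p.toAddSubgroup T.toAddMonoidHom hker with
      map_smul' := by rintro a ⟨x⟩; exact T.map_smul a x }
  let g : N →ₗ[ℂ] (M ⧸ p) := p.mkQ ∘ₗ S
  have hfc : Continuous f := continuous_quot_lift _ hT
  have hgc : Continuous g := continuous_quot_mk.comp hS
  have hgf : ∀ x, g (f x) = x := by
    intro x
    obtain ⟨m, rfl⟩ := Submodule.Quotient.mk_surjective _ x
    exact (Submodule.Quotient.eq _).mpr (hST m)
  exact ⟨{ f with
    invFun := g
    left_inv := hgf
    right_inv := hTS
    continuous_toFun := hfc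
    continuous_invFun := hgc }, fun m => rfl⟩

/-- If `P` is a right inverse up to the mean, and a left inverse up to constants, of `D`, then
`Φ ↦ Φ ∘ D` is an isomorphism of the quotient of the dual by the multiples of the integral onto
`𝔉⁰`. -/
theorem exists_equiv_FHom {D : V →L[ℂ] W} {P : W →L[ℂ] V} {J : W →L[ℂ] ℂ} {one : W}
    (hD : ∀ e : V, (∃ c : ℂ, ∀ᵐ t ∂(volume : Measure S1), ρ e t = c) → D e = 0)
    (hJ : ∀ x, J x = ∫ t, σ x t) (hone : J one = 1)
    (hDP : ∀ x, D (P x) = x - J x • one)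
    (hPD : ∀ y, ∃ c : ℂ, ∀ᵐ t ∂(volume : Measure S1), ρ (P (D y) - y) t = c) :
    ∃ e : ((W →L_c[ℂ] ℂ) ⧸ integralLine σ) ≃L[ℂ] FHom ρ 0,
      ∀ (Φ : W →L_c[ℂ] ℂ) (ζ : ℂ) (y : V), (e (Submodule.Quotient.mk Φ)).1 (ζ, y) = Φ (D y) := by
  have hDPD : ∀ y, D (P (D y)) = D y := fun y => by
    have := hD _ (hPD y)
    rwa [map_sub, sub_eq_zero] at this
  -- Comparing D P D = D with D P = 1 - J · one leaves J(Dy) · one = 0, and J(one) = 1.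
  have hJD : ∀ y, J (D y) = 0 := fun y => by
    have h := hDPD y
    rw [hDP, sub_eq_self] at h
    simpa [hone] using congrArg J h
  have hker : ∀ Φ ∈ integralLine σ, pairingLinear (ρ := ρ) D hD Φ = 0 := by
    rintro Φ ⟨c, hc⟩
    apply Subtype.ext
    apply ContinuousMap.ext
    intro q
    show Φ (D q.2) = 0
    rw [hc, ← hJ, hJD, mul_zero]
  have hTS : ∀ F, pairingLinear (ρ := ρ) D hD (pullPrimitive P F) = F := by
    intro F
    apply Subtype.ext
    apply ContinuousMap.ext
    intro q
    show F.1 (0, P (D q.2)) = F.1 (q.1, q.2)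
    -- Invariance under constants absorbs the difference between P(Dy) and y.
    rw [FHom.apply_eq_apply_zero F.2 q.1 q.2, ← F.2.1.2.2.2 0 q.2 _ (hPD q.2), add_sub_cancel]
  have hST : ∀ Φ, pullPrimitive P (pairingLinear (ρ := ρ) D hD Φ) - Φ ∈ integralLine σ := by
    intro Φ
    refine ⟨-Φ one, fun x => ?_⟩
    show Φ (D (P x)) - Φ x = _
    rw [hDP, map_sub, map_smul, ← hJ, smul_eq_mul]
    ring
  obtain ⟨e, he⟩ := exists_quotient_equiv (continuous_pairingLinear (ρ := ρ) D hD)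
    (continuous_pullPrimitive P) hker hTS hST
  refine ⟨e, fun Φ ζ y => ?_⟩
  rw [he]
  rfl

end FSpaceLemmas

/-! ### Spaces of functions on the circle with an abstract derivative -/

/-- `c'` is the derivative of `c`. -/
def HasCircleDeriv (c c' : C(S1, ℂ)) : Prop :=
  ∀ s : ℝ, HasDerivAt (fun s : ℝ => c (s : S1)) (c' (s : S1)) s

/-- A normed space `E` of (classes of) functions on the circle that contains the constants, with
a continuous primitive `P`: `P v` is thought of as a primitive of `v - ∫ v`. -/
structure CircleModel (E : Type) [NormedAddCommGroup E] [NormedSpace ℂ E] where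
  ev : E → S1 → ℂ
  J : E →L[ℂ] ℂ
  P : E →L[ℂ] E
  one : E
  J_eq : ∀ u, J u = ∫ t, ev u t
  J_one : J one = 1
  P_one : P one = 0
  ev_const : ∀ u, (∃ c : ℂ, ∀ᵐ t ∂(volume : Measure S1), ev u t = c) ↔ ∃ c : ℂ, u = c • one
  -- Injectivity of `P`, modulo constants, on mean zero elements: this is what makes derivatives
  -- unique.
  eq_zero_of_P : ∀ (v : E) (c : ℂ), J v = 0 → P v = c • one → v = 0

namespace CircleModel

variable {E : Type} [NormedAddCommGroup E] [NormedSpace ℂ E] (M : CircleModel E)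

/-- `v` is the derivative of `u`. -/
def HasDeriv (u v : E) : Prop := M.J v = 0 ∧ ∃ c : ℂ, u = M.P v + c • M.one

variable {M}

lemma HasDeriv.add {u v u' v' : E} (h : M.HasDeriv u v) (h' : M.HasDeriv u' v') :
    M.HasDeriv (u + u') (v + v') := by
  obtain ⟨h1, c, rfl⟩ := h
  obtain ⟨h1', c', rfl⟩ := h'
  refine ⟨by simp [h1, h1'], c + c', ?_⟩
  rw [map_add, add_smul]
  abel

lemma HasDeriv.smul {u v : E} (a : ℂ) (h : M.HasDeriv u v) : M.HasDeriv (a • u) (a • v) := by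
  obtain ⟨h1, c, rfl⟩ := h
  refine ⟨by simp [h1], a * c, ?_⟩
  rw [map_smul, smul_add, smul_smul]

lemma HasDeriv.unique {u v v' : E} (h : M.HasDeriv u v) (h' : M.HasDeriv u v') : v = v' := by
  obtain ⟨h1, c, rfl⟩ := h
  obtain ⟨h1', c', h2⟩ := h'
  refine sub_eq_zero.mp (M.eq_zero_of_P (v - v') (c' - c) (by simp [h1, h1']) ?_)
  rw [map_sub, sub_smul, sub_eq_sub_iff_add_eq_add, h2]
  abel

lemma hasDeriv_const (c : ℂ) : M.HasDeriv (c • M.one) 0 := ⟨by simp, c, by simp⟩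

lemma hasDeriv_P (v : E) : M.HasDeriv (M.P v) (v - M.J v • M.one) :=
  ⟨by simp [M.J_one], 0, by simp [M.P_one]⟩

/-! ### Continuous families of jets -/

variable {X Y : Type} [TopologicalSpace X] [TopologicalSpace Y]

variable (M) in
/-- The derivatives of order at most `n` of the family `u` exist and depend continuously on the
parameter. -/
def IsJet : ℕ → (X → E) → Prop
  | 0, u => Continuous u
  | n + 1, u => Continuous u ∧ ∃ v : X → E, (∀ x, M.HasDeriv (u x) (v x)) ∧ IsJet n v

lemma IsJet.continuous : ∀ {n : ℕ} {u : X → E}, M.IsJet n u → Continuous u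
  | 0, _, h => h
  | _ + 1, _, h => h.1

lemma IsJet.of_succ {n : ℕ} : ∀ {u : X → E}, M.IsJet (n + 1) u → M.IsJet n u := by
  induction n with
  | zero => exact fun h => h.1
  | succ n ih =>
    rintro u ⟨hu, v, huv, hv⟩
    exact ⟨hu, v, huv, ih hv⟩

lemma IsJet.comp {n : ℕ} {g : Y → X} (hg : Continuous g) :
    ∀ {u : X → E}, M.IsJet n u → M.IsJet n (u ∘ g) := by
  induction n with
  | zero => exact fun h => Continuous.comp h hg
  | succ n ih =>
    rintro u ⟨hu, v, huv, hv⟩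
    exact ⟨hu.comp hg, v ∘ g, fun x => huv (g x), ih hv⟩

lemma IsJet.add {n : ℕ} : ∀ {u u' : X → E}, M.IsJet n u → M.IsJet n u' →
    M.IsJet n (fun x => u x + u' x) := by
  induction n with
  | zero => exact fun h h' => Continuous.add h h'
  | succ n ih =>
    rintro u u' ⟨hu, v, huv, hv⟩ ⟨hu', v', huv', hv'⟩
    exact ⟨hu.add hu', _, fun x => (huv x).add (huv' x), ih hv hv'⟩

/-- The derivative hidden in the existential of `IsJet` is unique, so it is the prescribed one. -/
lemma IsJet.deriv {n : ℕ} {u v : X → E} (h : M.IsJet (n + 1) u)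
    (huv : ∀ x, M.HasDeriv (u x) (v x)) : M.IsJet n v := by
  obtain ⟨-, v', huv', hv'⟩ := h
  rwa [show v = v' from funext fun x => (huv x).unique (huv' x)]

lemma isJet_smul_one (n : ℕ) {c : X → ℂ} (hc : Continuous c) :
    M.IsJet n (fun x => c x • M.one) := by
  have h0 : ∀ n, M.IsJet n (fun _ : X => (0 : E)) := by
    intro n
    induction n with
    | zero => exact continuous_const
    | succ n ih => exact ⟨continuous_const, _, fun _ => by simpa using M.hasDeriv_const 0, ih⟩
  cases n with
  | zero => exact hc.smul continuous_const
  | succ n => exact ⟨hc.smul continuous_const, _, fun x => M.hasDeriv_const (c x), h0 n⟩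

/-- Integration gains one order: the derivative of `P u` is u minus its mean, again an n-jet. -/
lemma IsJet.P {n : ℕ} {u : X → E} (h : M.IsJet n u) : M.IsJet (n + 1) (fun x => M.P (u x)) := by
  refine ⟨M.P.continuous.comp h.continuous, _, fun x => M.hasDeriv_P (u x), ?_⟩
  have := h.add (M.isJet_smul_one n (c := fun x => -M.J (u x))
    (M.J.continuous.comp h.continuous).neg)
  simpa [sub_eq_add_neg] using this

/-- `V` is the space of the elements of `E` with `l` derivatives. -/
structure Realizes (M : CircleModel E) (l : ℕ∞) {V : Type} [AddCommGroup V] [Module ℂ V]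
    [TopologicalSpace V] (ρ : V → S1 → ℂ) (ι : V →ₗ[ℂ] E) : Prop where
  injective : Function.Injective ι
  eq_ev : ∀ x, ρ x = M.ev (ι x)
  exists_of_isJet : ∀ u : E, (∀ n : ℕ, (n : ℕ∞) ≤ l → M.IsJet n (fun _ : Unit => u)) →
    ∃ x, ι x = u
  -- Allowing every parameter space characterizes the topology of `V`. The identity of `V` shows
  -- that `ι` is itself a jet; other families give continuity of operators into `V`.
  continuous_iff : ∀ {X : Type} [TopologicalSpace X] (T : X → V),
    Continuous T ↔ ∀ n : ℕ, (n : ℕ∞) ≤ l → M.IsJet n (fun x => ι (T x))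

section Realizes

variable {l l' : ℕ∞} {V W : Type} [AddCommGroup V] [Module ℂ V] [TopologicalSpace V]
  [AddCommGroup W] [Module ℂ W] [TopologicalSpace W] {ρ : V → S1 → ℂ} {σ : W → S1 → ℂ}
  {ι : V →ₗ[ℂ] E} {κ : W →ₗ[ℂ] E}

lemma Realizes.isJet (hV : M.Realizes l ρ ι) {n : ℕ} (hn : (n : ℕ∞) ≤ l) : M.IsJet n ι :=
  (hV.continuous_iff id).mp continuous_id n hn

/-- A linear map into `E` whose values have continuous derivatives lifts to `W`. -/
lemma Realizes.exists_lift (hW : M.Realizes l' σ κ) (f : V →ₗ[ℂ] E)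
    (hf : ∀ n : ℕ, (n : ℕ∞) ≤ l' → M.IsJet n f) : ∃ T : V →L[ℂ] W, ∀ x, κ (T x) = f x := by
  have hex : ∀ x, ∃ w, κ w = f x := fun x => hW.exists_of_isJet _ fun n hn =>
    (hf n hn).comp (continuous_const : Continuous fun _ : Unit => x)
  choose T hT using hex
  refine ⟨⟨⟨⟨T, fun x y => hW.injective ?_⟩, fun c x => hW.injective ?_⟩, ?_⟩, hT⟩
  · simp [hT]
  · simp [hT]
  · refine (hW.continuous_iff T).mpr fun n hn => ?_
    simpa [hT] using hf n hn

end Realizes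

/-- The operators `u ↦ c · (u ∘ h)` on `E`, where `h` has the derivative `θ`. -/
structure Pullback (M : CircleModel E) (h : S1 → S1) (θ : C(S1, ℂ)) where
  T : C(S1, ℂ) → E →L[ℂ] E
  T_zero : ∀ u, T 0 u = 0
  ev_T : ∀ c u, ∀ᵐ t ∂(volume : Measure S1), M.ev (T c u) t = c t * M.ev u (h t)
  hasDeriv_T : ∀ {c c' : C(S1, ℂ)} {u v : E}, HasCircleDeriv c c' → M.HasDeriv u v →
    M.HasDeriv (T c u) (T c' u + T (c * θ) v)

end CircleModel

lemma IsCk.exists_hasCircleDeriv {n : ℕ} {c : C(S1, ℂ)} (hc : IsCk (n + 1 : ℕ) c) :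
    ∃ c' : C(S1, ℂ), HasCircleDeriv c c' ∧ IsCk n c' := by
  have hc1 : IsCk ((n : ℕ∞) + 1) c := by exact_mod_cast hc
  have hd := hc1.circleDeriv
  refine ⟨⟨_, hd.continuous⟩, fun s => ?_, hd⟩
  have h := congrFun (circleDeriv_coe c) s
  show HasDerivAt _ (LoopSpace.circleDeriv c s) s
  rw [h]
  have hdiff : Differentiable ℝ (fun s : ℝ => c (s : S1)) :=
    ContDiff.differentiable hc (by simp)
  exact (hdiff s).hasDerivAt

lemma IsCk.mul {l : ℕ∞} {f g : S1 → ℂ} (hf : IsCk l f) (hg : IsCk l g) : IsCk l (f * g) :=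
  ContDiff.mul hf hg

lemma IsCk.mono {l l' : ℕ∞} {f : S1 → ℂ} (hf : IsCk l f) (h : l' ≤ l) : IsCk l' f :=
  ContDiff.of_le hf (by exact_mod_cast h)

lemma isCk_const (l : ℕ∞) (c : ℂ) : IsCk l (fun _ => c) :=
  (contDiff_const : ContDiff ℝ (l : WithTop ℕ∞) (fun _ : ℝ => c))

namespace CircleModel

variable {E : Type} [NormedAddCommGroup E] [NormedSpace ℂ E] {M : CircleModel E}
  {X : Type} [TopologicalSpace X]

/-- Induction with c arbitrary, since the derivative of c (u ∘ h) is c' (u ∘ h) + cθ (v ∘ h), with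
new multipliers. Only n - 1 derivatives of θ are used; for n = 0 the truncated subtraction asks for
mere continuity. -/
lemma Pullback.isJet {h : S1 → S1} {θ : C(S1, ℂ)} (Q : M.Pullback h θ) {n : ℕ} :
    ∀ {c : C(S1, ℂ)} {u : X → E}, IsCk n c → IsCk (n - 1 : ℕ) θ → M.IsJet n u →
      M.IsJet n (fun x => Q.T c (u x)) := by
  induction n with
  | zero => exact fun _ _ hu => (Q.T _).continuous.comp hu
  | succ n ih =>
    intro c u hc hθ hu
    obtain ⟨c', hcc', hc'⟩ := hc.exists_hasCircleDeriv
    obtain ⟨hu0, v, huv, hv⟩ := id hu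
    have hθ' : IsCk (n - 1 : ℕ) θ := hθ.mono (by exact_mod_cast (by omega : n - 1 ≤ n + 1 - 1))
    refine ⟨(Q.T c).continuous.comp hu0, _, fun x => Q.hasDeriv_T hcc' (huv x), ?_⟩
    refine (ih hc' hθ' hu.of_succ).add (ih ?_ hθ' hv)
    exact (hc.mono (by exact_mod_cast Nat.le_succ n)).mul hθ

variable {l : ℕ∞} {V W : Type} [AddCommGroup V] [Module ℂ V] [TopologicalSpace V]
  [AddCommGroup W] [Module ℂ W] [TopologicalSpace W] {ρ : V → S1 → ℂ} {σ : W → S1 → ℂ}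
  {ι : V →ₗ[ℂ] E} {κ : W →ₗ[ℂ] E}

/-- The description of `𝔉⁰` for the functions with `l + 1` derivatives in a model `E`. -/
theorem exists_equivariant_equiv (hV : M.Realizes (l + 1) ρ ι) (hW : M.Realizes l σ κ)
    (dot : V → W) (hdot : ∀ y, M.HasDeriv (ι y) (κ (dot y))) {k : ℕ∞}
    (hQ : ∀ φ : CircleDiffeo k, ∃ θ : C(S1, ℂ), (∀ t, θ t = φ.deriv t) ∧ IsCk l θ ∧
      Nonempty (M.Pullback φ.toHomeomorph θ)) :
    (∀ F ∈ FSpace ρ, F ∈ FHom ρ 0 ↔ IsGFixed F) ∧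
    Module.finrank ℂ (integralLine σ) = 1 ∧
    ∃ e : ((W →L_c[ℂ] ℂ) ⧸ integralLine σ) ≃L[ℂ] FHom ρ 0,
      (∀ (Φ : W →L_c[ℂ] ℂ) (ζ : ℂ) (y : V),
        (e (Submodule.Quotient.mk Φ)).1 (ζ, y) = Φ (dot y)) ∧
      ∀ φ : CircleDiffeo k, ∃ (A : V →L[ℂ] V) (B : W →L[ℂ] W),
        IsFunctionPullback φ ρ A ∧ IsFormPullback φ σ B ∧
        ∀ Φ Ψ : W →L_c[ℂ] ℂ, (∀ x, Ψ x = Φ (B x)) → ∀ (ζ : ℂ) (y : V),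
          (e (Submodule.Quotient.mk Ψ)).1 (ζ, y) = (e (Submodule.Quotient.mk Φ)).1 (ζ, A y) := by
  have hVl : ∀ n : ℕ, (n : ℕ∞) ≤ l → M.IsJet (n + 1) ι := fun n hn =>
    hV.isJet (by push_cast; gcongr)
  let D : V →L[ℂ] W :=
    ⟨⟨⟨dot, fun x y => hW.injective ((hdot (x + y)).unique (by
        simpa using (hdot x).add (hdot y)))⟩,
      fun c x => hW.injective ((hdot (c • x)).unique (by simpa using (hdot x).smul c))⟩,
      (hW.continuous_iff dot).mpr fun n hn => (hVl n hn).deriv hdot⟩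
  have hDdot : ∀ y, D y = dot y := fun y => rfl
  -- An order n + 1 ≤ l + 1 of the primitive needs only the order n ≤ l of the form.
  obtain ⟨P, hP⟩ := hV.exists_lift (V := W) ((M.P : E →ₗ[ℂ] E) ∘ₗ κ) (fun n hn => by
    cases n with
    | zero => exact M.P.continuous.comp (hW.isJet (n := 0) (by simp))
    | succ n =>
      have hn' : (n : ℕ∞) ≤ l := by
        push_cast at hn
        exact (ENat.add_le_add_iff_right (by simp)).mp hn
      exact (hW.isJet hn').P)
  have hP' : ∀ x, ι (P x) = M.P (κ x) := hP
  obtain ⟨one, hone⟩ := hW.exists_of_isJet M.one fun n _ => by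
    simpa using M.isJet_smul_one n (continuous_const : Continuous fun _ : Unit => (1 : ℂ))
  have hκ : Continuous κ := hW.isJet (n := 0) (by simp)
  let J : W →L[ℂ] ℂ := ⟨(M.J : E →ₗ[ℂ] ℂ) ∘ₗ κ, M.J.continuous.comp hκ⟩
  have hJ' : ∀ x, J x = M.J (κ x) := fun x => rfl
  have hJ : ∀ x, J x = ∫ t, σ x t := fun x => by rw [hJ', M.J_eq, hW.eq_ev]
  have hJone : J one = 1 := by rw [hJ', hone, M.J_one]
  have hD : ∀ e : V, (∃ c : ℂ, ∀ᵐ t ∂(volume : Measure S1), ρ e t = c) → D e = 0 := by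
    intro e he
    rw [hV.eq_ev, M.ev_const] at he
    obtain ⟨c, hc⟩ := he
    refine hW.injective ((hdot e).unique ?_)
    rw [hc, map_zero]
    exact M.hasDeriv_const c
  have hDP : ∀ x, D (P x) = x - J x • one := fun x => by
    refine hW.injective ((hdot (P x)).unique ?_)
    rw [hP', map_sub, map_smul, hone]
    exact M.hasDeriv_P (κ x)
  have hPD : ∀ y, ∃ c : ℂ, ∀ᵐ t ∂(volume : Measure S1), ρ (P (D y) - y) t = c := fun y => by
    rw [hV.eq_ev, M.ev_const, map_sub, hP']
    obtain ⟨-, c, hc⟩ := hdot y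
    exact ⟨-c, by rw [hc, hDdot, neg_smul]; abel⟩
  obtain ⟨e, he⟩ := exists_equiv_FHom hD hJ hJone hDP hPD
  refine ⟨fun F hF => mem_FHom_zero_iff_isGFixed hF, finrank_integralLine hJ hJone, e, he,
    fun φ => ?_⟩
  obtain ⟨θ, hθ, hθl, ⟨Q⟩⟩ := hQ φ
  -- Functions are pulled back with multiplier 1, so order n ≤ l + 1 requires only n - 1 ≤ l
  -- derivatives of θ = φ'. One-forms, below, have multiplier θ and order at most l.
  obtain ⟨A, hA⟩ := hV.exists_lift ((Q.T 1 : E →ₗ[ℂ] E) ∘ₗ ι) (fun n hn => by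
    refine Q.isJet (isCk_const n 1) (hθl.mono ?_) (hV.isJet hn)
    cases n with
    | zero => simp
    | succ n =>
      push_cast at hn
      exact (ENat.add_le_add_iff_right (by simp)).mp hn)
  obtain ⟨B, hB⟩ := hW.exists_lift ((Q.T θ : E →ₗ[ℂ] E) ∘ₗ κ) (fun n hn =>
    Q.isJet (hθl.mono hn)
      (hθl.mono (le_trans (by exact_mod_cast Nat.sub_le n 1) hn)) (hW.isJet hn))
  have hA' : ∀ y, ι (A y) = Q.T 1 (ι y) := hA
  have hB' : ∀ x, κ (B x) = Q.T θ (κ x) := hB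
  refine ⟨A, B, fun y => ?_, fun x => ?_, fun Φ Ψ hΨ ζ y => ?_⟩
  · rw [hV.eq_ev, hV.eq_ev, hA']
    filter_upwards [Q.ev_T 1 (ι y)] with t ht
    simpa using ht
  · rw [hW.eq_ev, hW.eq_ev, hB']
    filter_upwards [Q.ev_T θ (κ x)] with t ht
    rw [ht, hθ, mul_comm]
  · rw [he, he, hΨ]
    -- It remains that dot(A y) = B(dot y): the chain rule, which is `hasDeriv_T` with c = 1 and c'
    -- = 0.
    congr 1
    refine hW.injective (HasDeriv.unique ?_ (hdot (A y)))
    have h1 : HasCircleDeriv 1 0 := fun s => hasDerivAt_const s (1 : ℂ)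
    have := Q.hasDeriv_T h1 (hdot y)
    rwa [Q.T_zero, zero_add, one_mul, ← hB', ← hA'] at this

end CircleModel

/-! ### Primitives of integrable functions on the circle -/

instance : IsProbabilityMeasure (volume : Measure S1) := ⟨UnitAddCircle.measure_univ⟩

/-- The lift to `ℝ` of a primitive of `f - ∫ f`. -/
def primFun (f : S1 → ℂ) (s : ℝ) : ℂ := ∫ u in (0 : ℝ)..s, (f (u : S1) - ∫ t, f t)

/-- The line is a countable union of unit intervals, each projecting to the circle with measure
preserved. -/
lemma ae_coe {q : S1 → Prop} (h : ∀ᵐ t ∂(volume : Measure S1), q t) :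
    ∀ᵐ s : ℝ, q (s : S1) := by
  have h1 : ∀ n : ℤ, ∀ᵐ s : ℝ ∂(volume.restrict (Set.Ioc (n : ℝ) (n + 1))),
      q (s : S1) := fun n =>
    (UnitAddCircle.measurePreserving_mk (n : ℝ)).quasiMeasurePreserving.ae h
  have h2 := (ae_restrict_iUnion_iff (μ := (volume : Measure ℝ))
    (fun n : ℤ => Set.Ioc (n : ℝ) (n + 1)) (fun s : ℝ => q (s : S1))).mpr h1
  rwa [iUnion_Ioc_intCast, Measure.restrict_univ] at h2

lemma periodic_coe (f : S1 → ℂ) : Function.Periodic (fun s : ℝ => f (s : S1)) 1 := fun s => by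
  simp

lemma intervalIntegrable_coe {f : S1 → ℂ} (hf : Integrable f volume) (a b : ℝ) :
    IntervalIntegrable (fun s : ℝ => f (s : S1)) volume a b := by
  refine (periodic_coe f).intervalIntegrable one_ne_zero (t := 0) ?_ a b
  rw [intervalIntegrable_iff_integrableOn_Ioc_of_le (by simp)]
  exact (UnitAddCircle.measurePreserving_mk 0).integrable_comp_of_integrable hf

lemma intervalIntegrable_coe_sub {f : S1 → ℂ} (hf : Integrable f volume) (c : ℂ) (a b : ℝ) :
    IntervalIntegrable (fun s : ℝ => f (s : S1) - c) volume a b :=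
  (intervalIntegrable_coe hf a b).sub intervalIntegrable_const

lemma primFun_congr {f g : S1 → ℂ} (h : f =ᵐ[volume] g) : primFun f = primFun g := by
  funext s
  rw [primFun, primFun, integral_congr_ae h]
  refine intervalIntegral.integral_congr_ae ?_
  filter_upwards [ae_coe h] with u hu _
  rw [hu]

/-- Subtracting the mean makes the integral over each period vanish. -/
lemma primFun_periodic {f : S1 → ℂ} (hf : Integrable f volume) :
    Function.Periodic (primFun f) 1 := by
  intro s
  have h1 : primFun f (s + 1) - primFun f s = ∫ u in s..(s + 1), (f (u : S1) - ∫ t, f t) :=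
    intervalIntegral.integral_interval_sub_left (intervalIntegrable_coe_sub hf _ _ _)
      (intervalIntegrable_coe_sub hf _ _ _)
  rw [UnitAddCircle.intervalIntegral_preimage s (fun u => f u - ∫ t, f t),
    integral_sub hf (integrable_const _)] at h1
  simpa [sub_eq_zero] using h1

lemma continuous_primFun {f : S1 → ℂ} (hf : Integrable f volume) : Continuous (primFun f) :=
  intervalIntegral.continuous_primitive (fun a b => intervalIntegrable_coe_sub hf _ a b) 0

lemma norm_primFun_le {f : S1 → ℂ} (hf : Integrable f volume) {s : ℝ} (hs : s ∈ Set.Icc (0 : ℝ) 1) :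
    ‖primFun f s‖ ≤ 2 * ∫ t, ‖f t‖ := by
  calc ‖primFun f s‖ ≤ ∫ u in (0 : ℝ)..s, ‖f (u : S1) - ∫ t, f t‖ :=
        intervalIntegral.norm_integral_le_integral_norm hs.1
    _ ≤ ∫ u in (0 : ℝ)..1, ‖f (u : S1) - ∫ t, f t‖ := by
        refine intervalIntegral.integral_mono_interval le_rfl hs.1 hs.2
          (ae_of_all _ fun u => norm_nonneg _) (intervalIntegrable_coe_sub hf _ _ _).norm
    _ = ∫ t, ‖f t - ∫ t, f t‖ := by
        have := UnitAddCircle.intervalIntegral_preimage 0 (fun u => ‖f u - ∫ t, f t‖)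
        simpa using this
    -- The factor 2 comes from f and its mean, each contributing at most the L¹ norm of f.
    _ ≤ ∫ t, (‖f t‖ + ∫ t, ‖f t‖) := by
        refine integral_mono (hf.sub (integrable_const _)).norm
          (hf.norm.add (integrable_const _)) fun t => ?_
        exact (norm_sub_le _ _).trans (by gcongr; exact norm_integral_le_integral_norm _)
    _ = 2 * ∫ t, ‖f t‖ := by
        rw [integral_add hf.norm (integrable_const _)]
        simp
        ring

/-- The primitive of `f - ∫ f` that vanishes at the origin. -/
def prim (f : S1 → ℂ) (hf : Integrable f volume) : C(S1, ℂ) :=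
  ⟨(primFun_periodic hf).lift, continuous_of_coe (by
    simpa [Function.Periodic.lift_coe] using continuous_primFun hf)⟩

lemma prim_coe {f : S1 → ℂ} (hf : Integrable f volume) (s : ℝ) :
    prim f hf (s : S1) = primFun f s := (primFun_periodic hf).lift_coe s

lemma exists_coe_Icc (t : S1) : ∃ s ∈ Set.Icc (0 : ℝ) 1, (s : S1) = t := by
  obtain ⟨s, hs, hst⟩ := (AddCircle.coe_image_Icc_eq (1 : ℝ) 0).symm.subset (Set.mem_univ t)
  exact ⟨s, by simpa using hs, hst⟩

lemma norm_prim_le {f : S1 → ℂ} (hf : Integrable f volume) : ‖prim f hf‖ ≤ 2 * ∫ t, ‖f t‖ := by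
  refine (ContinuousMap.norm_le _ (by positivity)).mpr fun t => ?_
  obtain ⟨s, hs, rfl⟩ := exists_coe_Icc t
  rw [prim_coe]
  exact norm_primFun_le hf hs

/-! ### The pairing of `L^p` functions with continuous functions -/

section Lp

variable {p : ℝ≥0∞} [Fact (1 ≤ p)]

lemma integrable_Lp (u : Lp ℂ p (volume : Measure S1)) : Integrable u volume :=
  (Lp.memLp u).integrable Fact.out

lemma integral_norm_le_norm (u : Lp ℂ p (volume : Measure S1)) : ∫ t, ‖u t‖ ≤ ‖u‖ := by
  rw [integral_norm_eq_lintegral_enorm (Lp.aestronglyMeasurable u), Lp.norm_def,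
    ← eLpNorm_one_eq_lintegral_enorm]
  exact ENNReal.toReal_mono (Lp.eLpNorm_ne_top u)
    (eLpNorm_le_eLpNorm_of_exponent_le Fact.out (Lp.aestronglyMeasurable u))

variable (p) in
/-- `(u, c) ↦ ∫ u c`. -/
def pairLp : Lp ℂ p (volume : Measure S1) →L[ℂ] C(S1, ℂ) →L[ℂ] ℂ :=
  LinearMap.mkContinuous₂ (LinearMap.mk₂ ℂ (fun u c => ∫ t, u t * c t)
    (fun u u' c => by
      rw [← integral_add (integrable_mul_of_continuous u c.continuous)
        (integrable_mul_of_continuous u' c.continuous)]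
      refine integral_congr_ae ?_
      filter_upwards [Lp.coeFn_add u u'] with t ht
      rw [ht, Pi.add_apply, add_mul])
    (fun a u c => by
      rw [smul_eq_mul, ← integral_const_mul]
      refine integral_congr_ae ?_
      filter_upwards [Lp.coeFn_smul a u] with t ht
      rw [ht, Pi.smul_apply, smul_eq_mul, mul_assoc])
    (fun u c c' => by
      rw [← integral_add (integrable_mul_of_continuous u c.continuous)
        (integrable_mul_of_continuous u c'.continuous)]
      simp [mul_add])
    (fun a u c => by
      rw [smul_eq_mul, ← integral_const_mul]
      simp [mul_left_comm])) 1 (fun u c => by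
    calc ‖∫ t, u t * c t‖ ≤ ∫ t, ‖u t‖ * ‖c‖ := by
          refine norm_integral_le_of_norm_le ((integrable_Lp u).norm.mul_const _)
            (ae_of_all _ fun t => ?_)
          rw [norm_mul]
          gcongr
          exact c.norm_coe_le_norm t
      _ = (∫ t, ‖u t‖) * ‖c‖ := integral_mul_const _ _
      _ ≤ 1 * ‖u‖ * ‖c‖ := by rw [one_mul]; gcongr; exact integral_norm_le_norm u)

lemma pairLp_apply (u : Lp ℂ p (volume : Measure S1)) (c : C(S1, ℂ)) :
    pairLp p u c = ∫ t, u t * c t := rfl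

variable (p) in
/-- `u ↦ ∫ u`. -/
def meanLp : Lp ℂ p (volume : Measure S1) →L[ℂ] ℂ := (pairLp p).flip 1

lemma meanLp_apply (u : Lp ℂ p (volume : Measure S1)) : meanLp p u = ∫ t, u t := by
  show ∫ t, u t * (1 : C(S1, ℂ)) t = _
  simp

variable (p) in
/-- The primitive of `u - ∫ u` that vanishes at the origin. -/
def primLp : Lp ℂ p (volume : Measure S1) →L[ℂ] C(S1, ℂ) :=
  LinearMap.mkContinuous
    { toFun := fun u => prim u (integrable_Lp u)
      map_add' := fun u v => by
        ext t
        obtain ⟨s, -, rfl⟩ := exists_coe_Icc t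
        rw [ContinuousMap.add_apply, prim_coe, prim_coe, prim_coe,
          primFun_congr (Lp.coeFn_add u v), primFun, primFun, primFun,
          ← intervalIntegral.integral_add (intervalIntegrable_coe_sub (integrable_Lp u) _ _ _)
            (intervalIntegrable_coe_sub (integrable_Lp v) _ _ _)]
        simp only [Pi.add_apply, integral_add (integrable_Lp u) (integrable_Lp v)]
        congr 1
        funext x
        ring
      map_smul' := fun a u => by
        ext t
        obtain ⟨s, -, rfl⟩ := exists_coe_Icc t
        rw [ContinuousMap.smul_apply, prim_coe, prim_coe, primFun_congr (Lp.coeFn_smul a u),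
          primFun, primFun, RingHom.id_apply, smul_eq_mul, ← intervalIntegral.integral_const_mul]
        simp only [Pi.smul_apply, smul_eq_mul, integral_const_mul, mul_sub] } 2 (fun u => by
    refine (norm_prim_le (integrable_Lp u)).trans ?_
    gcongr
    exact integral_norm_le_norm u)

lemma primLp_coe (u : Lp ℂ p (volume : Measure S1)) (s : ℝ) :
    primLp p u (s : S1) = primFun u s := prim_coe (integrable_Lp u) s

variable (p) in
/-- The inclusion of the continuous functions into `L^p`. -/
abbrev incl : C(S1, ℂ) →L[ℂ] Lp ℂ p (volume : Measure S1) := ContinuousMap.toLp p volume ℂ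

lemma incl_ae (c : C(S1, ℂ)) : incl p c =ᵐ[volume] c := ContinuousMap.coeFn_toLp volume c

lemma pairLp_incl (u c : C(S1, ℂ)) : pairLp p (incl p u) c = ∫ t, u t * c t := by
  rw [pairLp_apply]
  refine integral_congr_ae ?_
  filter_upwards [incl_ae (p := p) u] with t ht
  rw [ht]

lemma meanLp_incl (u : C(S1, ℂ)) : meanLp p (incl p u) = ∫ t, u t := by
  rw [meanLp_apply]
  exact integral_congr_ae (incl_ae u)

lemma primLp_incl_coe (u : C(S1, ℂ)) (s : ℝ) : primLp p (incl p u) (s : S1) = primFun u s := by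
  rw [primLp_coe, primFun_congr (incl_ae u)]

end Lp

/-- `u ↦ ∫ u`, on continuous functions. -/
def meanC : C(S1, ℂ) →L[ℂ] ℂ := (meanLp 1).comp (incl 1)

lemma meanC_apply (u : C(S1, ℂ)) : meanC u = ∫ t, u t := meanLp_incl u

/-- The primitive of `u - ∫ u` that vanishes at the origin, for continuous `u`. -/
def primC : C(S1, ℂ) →L[ℂ] C(S1, ℂ) := (primLp 1).comp (incl 1)

lemma primC_coe (u : C(S1, ℂ)) (s : ℝ) : primC u (s : S1) = primFun u s := primLp_incl_coe u s

lemma primLp_incl {p : ℝ≥0∞} [Fact (1 ≤ p)] (u : C(S1, ℂ)) : primLp p (incl p u) = primC u := by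
  ext t
  obtain ⟨s, -, rfl⟩ := exists_coe_Icc t
  rw [primLp_incl_coe, primC_coe]

/-! ### The classical derivative -/

lemma continuous_coe (u : C(S1, ℂ)) : Continuous fun s : ℝ => u (s : S1) :=
  u.continuous.comp (AddCircle.continuous_mk' 1)

lemma HasCircleDeriv.unique {u v v' : C(S1, ℂ)} (h : HasCircleDeriv u v)
    (h' : HasCircleDeriv u v') : v = v' := by
  ext t
  obtain ⟨s, -, rfl⟩ := exists_coe_Icc t
  exact (h s).unique (h' s)

lemma hasCircleDeriv_primC (v : C(S1, ℂ)) : HasCircleDeriv (primC v) (v - meanC v • 1) := by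
  intro s
  have h : Continuous fun u : ℝ => v (u : S1) - ∫ t, v t := (continuous_coe v).sub continuous_const
  have := (h.integral_hasStrictDerivAt 0 s).hasDerivAt
  simp only [primC_coe]
  simpa [meanC_apply] using! this

lemma HasCircleDeriv.integral_eq_sub {u v : C(S1, ℂ)} (h : HasCircleDeriv u v) (a b : ℝ) :
    ∫ s in a..b, v (s : S1) = u (b : S1) - u (a : S1) :=
  intervalIntegral.integral_eq_sub_of_hasDerivAt (fun s _ => h s)
    ((continuous_coe v).intervalIntegrable a b)

lemma HasCircleDeriv.meanC_eq_zero {u v : C(S1, ℂ)} (h : HasCircleDeriv u v) : meanC v = 0 := by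
  rw [meanC_apply, ← UnitAddCircle.intervalIntegral_preimage 0, h.integral_eq_sub,
    AddCircle.coe_add_period, sub_self]

lemma HasCircleDeriv.eq_primC {u v : C(S1, ℂ)} (h : HasCircleDeriv u v) :
    u = primC v + u 0 • 1 := by
  ext t
  obtain ⟨s, -, rfl⟩ := exists_coe_Icc t
  have h0 := h.meanC_eq_zero
  rw [meanC_apply] at h0
  have := h.integral_eq_sub 0 s
  simp only [ContinuousMap.add_apply, primC_coe, primFun, h0, sub_zero, this]
  simp

lemma HasCircleDeriv.add_const {u v : C(S1, ℂ)} (h : HasCircleDeriv u v) (c : ℂ) :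
    HasCircleDeriv (u + c • 1) v := fun s => by
  simpa using! (h s).add_const (c • 1 : ℂ)

lemma HasCircleDeriv.mul {u v u' v' : C(S1, ℂ)} (h : HasCircleDeriv u v)
    (h' : HasCircleDeriv u' v') : HasCircleDeriv (u * u') (v * u' + u * v') := fun s =>
  (h s).mul (h' s)

lemma hasCircleDeriv_const (c : ℂ) : HasCircleDeriv (c • 1) 0 := fun s =>
  hasDerivAt_const s (c • (1 : ℂ))

lemma HasCircleDeriv.circleDeriv_eq {u v : C(S1, ℂ)} (h : HasCircleDeriv u v) :
    circleDeriv u = v := by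
  funext t
  obtain ⟨s, -, rfl⟩ := exists_coe_Icc t
  exact (congrFun (circleDeriv_coe u) s).trans (h s).deriv

lemma zero_smul_one_continuousMap : (0 : ℂ) • (1 : C(S1, ℂ)) = 0 := by
  ext
  simp

/-- The fundamental theorem of calculus in both directions; it identifies the classical derivative
with the one defined through primitives in `CircleModel`. -/
lemma hasCircleDeriv_iff {u v : C(S1, ℂ)} :
    HasCircleDeriv u v ↔ meanC v = 0 ∧ ∃ c : ℂ, u = primC v + c • 1 := by
  refine ⟨fun h => ⟨h.meanC_eq_zero, _, h.eq_primC⟩, ?_⟩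
  rintro ⟨h, c, rfl⟩
  have := (hasCircleDeriv_primC v).add_const c
  rwa [h, zero_smul_one_continuousMap, sub_zero] at this

/-- The continuous functions with the classical derivative. -/
def modelC : CircleModel C(S1, ℂ) where
  ev u := u
  J := meanC
  P := primC
  one := 1
  J_eq := meanC_apply
  J_one := by simp [meanC_apply]
  P_one := by
    ext t
    obtain ⟨s, -, rfl⟩ := exists_coe_Icc t
    simp [primC_coe, primFun]
  ev_const u := by
    constructor
    · rintro ⟨c, hc⟩
      refine ⟨c, DFunLike.coe_injective ?_⟩
      refine (Continuous.ae_eq_iff_eq (volume : Measure S1) u.continuous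
        (c • (1 : C(S1, ℂ))).continuous).mp ?_
      filter_upwards [hc] with t ht
      simpa using ht
    · rintro ⟨c, rfl⟩
      exact ⟨c, ae_of_all _ fun t => by simp⟩
  eq_zero_of_P v c hv h := by
    have h1 := hasCircleDeriv_primC v
    rw [hv, zero_smul_one_continuousMap, sub_zero, h] at h1
    exact h1.unique (hasCircleDeriv_const c)

lemma modelC_hasDeriv_iff {u v : C(S1, ℂ)} : modelC.HasDeriv u v ↔ HasCircleDeriv u v :=
  hasCircleDeriv_iff.symm

/-! ### The weak derivative -/

lemma isCk_fourier (n : ℤ) : IsCk ⊤ (fourier n : C(S1, ℂ)) := by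
  unfold IsCk
  simp only [fourier_coe_apply]
  have : ContDiff ℝ ((⊤ : ℕ∞) : WithTop ℕ∞) (fun s : ℝ => (s : ℂ)) := Complex.ofRealCLM.contDiff
  fun_prop

lemma isCk_primC {ψ : C(S1, ℂ)} (hψ : IsCk ⊤ ψ) : IsCk ⊤ (primC ψ) := by
  have h := hasCircleDeriv_primC ψ
  have hd : deriv (fun s : ℝ => primC ψ (s : S1)) = fun s : ℝ => (ψ - meanC ψ • 1) (s : S1) :=
    funext fun s => (h s).deriv
  show ContDiff ℝ _ (fun s : ℝ => primC ψ (s : S1))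
  refine contDiff_infty_iff_deriv.mpr ⟨fun s => (h s).differentiableAt, ?_⟩
  rw [hd]
  have : ContDiff ℝ ((⊤ : ℕ∞) : WithTop ℕ∞) (fun s : ℝ => ψ (s : S1)) := hψ
  exact this.sub (contDiff_const (c := meanC ψ • (1 : ℂ)))

section Weak

variable {p : ℝ≥0∞} [Fact (1 ≤ p)]

/-- Fourier monomials are smooth with uniformly dense span, and the kernel of a continuous form is
closed. -/
lemma pairLp_eq_zero_of_smooth {u : Lp ℂ p (volume : Measure S1)}
    (h : ∀ φ : C(S1, ℂ), IsCk ⊤ φ → pairLp p u φ = 0) : pairLp p u = 0 := by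
  have hle : (Submodule.span ℂ (Set.range (@fourier 1))).topologicalClosure ≤
      LinearMap.ker (pairLp p u : C(S1, ℂ) →ₗ[ℂ] ℂ) := by
    refine Submodule.topologicalClosure_minimal _ ?_ (pairLp p u).isClosed_ker
    rw [Submodule.span_le]
    rintro _ ⟨n, rfl⟩
    exact h _ (isCk_fourier n)
  rw [span_fourier_closure_eq_top] at hle
  ext c
  exact hle (Submodule.mem_top (x := c))

/-- Thickened indicators are continuous and decrease to the indicator of a closed set K; dominated
convergence gives ∫_K u = 0 for every closed K, hence u = 0. -/
lemma eq_zero_of_pairLp_eq_zero {u : Lp ℂ p (volume : Measure S1)} (h : pairLp p u = 0) :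
    u = 0 := by
  rw [Lp.eq_zero_iff_ae_eq_zero]
  refine ae_eq_zero_of_forall_setIntegral_isClosed_eq_zero (integrable_Lp u) fun K hK => ?_
  have hδ : ∀ n : ℕ, (0 : ℝ) < 1 / ((n : ℝ) + 1) := fun n => by positivity
  have hlim := thickenedIndicator_tendsto_indicator_closure hδ
    tendsto_one_div_add_atTop_nhds_zero_nat K
  rw [hK.closure_eq, tendsto_pi_nhds] at hlim
  let g : ℕ → C(S1, ℂ) := fun n =>
    ⟨fun t => ((thickenedIndicator (hδ n) K t : ℝ) : ℂ), by fun_prop⟩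
  have hzero : ∀ n, ∫ t, u t * g n t = 0 := fun n => by
    rw [← pairLp_apply, h]
    rfl
  have hL : Tendsto (fun n => ∫ t, u t * g n t) atTop (𝓝 (∫ t, K.indicator u t)) := by
    refine tendsto_integral_of_dominated_convergence (fun t => ‖u t‖)
      (fun n => (integrable_mul_of_continuous u (g n).continuous).aestronglyMeasurable)
      (integrable_Lp u).norm (fun n => ae_of_all _ fun t => ?_) (ae_of_all _ fun t => ?_)
    · rw [norm_mul]
      refine mul_le_of_le_one_right (norm_nonneg _) ?_
      show ‖((thickenedIndicator (hδ n) K t : ℝ) : ℂ)‖ ≤ 1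
      simpa using thickenedIndicator_le_one (hδ n) K t
    · have h1 : Tendsto (fun n => g n t) atTop
          (𝓝 (((K.indicator (fun _ => (1 : NNReal)) t : NNReal) : ℝ) : ℂ)) :=
        ((Complex.continuous_ofReal.comp NNReal.continuous_coe).tendsto _).comp (hlim t)
      have h2 := h1.const_mul (u t)
      convert h2 using 2
      by_cases ht : t ∈ K <;> simp [ht]
  rw [← integral_indicator hK.measurableSet]
  refine tendsto_nhds_unique hL ?_
  simp [hzero]

/-- In terms of the continuous pairing, the relation is visibly closed in (u, v). -/
lemma hasWeakDeriv_iff_pairLp {u v : Lp ℂ p (volume : Measure S1)} :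
    HasWeakDeriv u v ↔ ∀ φ φ' : C(S1, ℂ), IsCk ⊤ φ → HasCircleDeriv φ φ' →
      pairLp p u φ' = -pairLp p v φ := by
  constructor
  · intro h φ φ' hφ hφ'
    have := h φ hφ
    rwa [hφ'.circleDeriv_eq] at this
  · intro h φ hφ
    have hd : HasCircleDeriv ⟨φ, hφ.continuous⟩ ⟨_, hφ.continuous_circleDeriv⟩ := by
      intro s
      have hdiff : Differentiable ℝ (fun s : ℝ => φ (s : S1)) :=
        ContDiff.differentiable hφ (by simp)
      have h1 := (hdiff s).hasDerivAt
      rw [← congrFun (circleDeriv_coe φ) s] at h1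
      exact h1
    exact h ⟨φ, hφ.continuous⟩ _ hφ hd

/-- Integration by parts: the derivative of a product has mean zero. -/
lemma HasCircleDeriv.hasWeakDeriv {u v : C(S1, ℂ)} (h : HasCircleDeriv u v) :
    HasWeakDeriv (incl p u) (incl p v) := by
  rw [hasWeakDeriv_iff_pairLp]
  intro φ φ' _ hφ
  have h0 := (h.mul hφ).meanC_eq_zero
  rw [map_add, meanC_apply, meanC_apply] at h0
  rw [pairLp_incl, pairLp_incl]
  simp only [ContinuousMap.mul_apply] at h0
  linear_combination h0

/-- The weak derivative is a closed operator. -/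
lemma isClosed_hasWeakDeriv {X : Type*} [TopologicalSpace X]
    {f g : X → Lp ℂ p (volume : Measure S1)} (hf : Continuous f) (hg : Continuous g) :
    IsClosed {x | HasWeakDeriv (f x) (g x)} := by
  simp only [hasWeakDeriv_iff_pairLp, Set.ofPred_forall]
  refine isClosed_iInter fun φ => isClosed_iInter fun φ' => isClosed_iInter fun _ =>
    isClosed_iInter fun _ => isClosed_eq ?_ ?_
  · exact (((pairLp p).flip φ').continuous).comp hf
  · exact ((((pairLp p).flip φ).continuous).comp hg).neg

variable (p) in
/-- The primitive as an operator on `L^p`. -/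
def primLpLp : Lp ℂ p (volume : Measure S1) →L[ℂ] Lp ℂ p (volume : Measure S1) :=
  (incl p).comp (primLp p)

/-- True classically for continuous v, which are dense in L^p as p < ∞; the relation is closed. -/
lemma hasWeakDeriv_primLpLp (hp : p ≠ ⊤) (v : Lp ℂ p (volume : Measure S1)) :
    HasWeakDeriv (primLpLp p v) (v - meanLp p v • incl p 1) := by
  refine (ContinuousMap.toLp_denseRange ℂ (volume : Measure S1) ℂ hp).induction_on v
    (isClosed_hasWeakDeriv (primLpLp p).continuous
      (continuous_id.sub ((meanLp p).continuous.smul continuous_const))) fun c => ?_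
  have := (hasCircleDeriv_primC c).hasWeakDeriv (p := p)
  rwa [map_sub, map_smul, meanC_apply, ← meanLp_incl (p := p), ← primLp_incl (p := p)] at this

lemma hasWeakDeriv_const (c : ℂ) : HasWeakDeriv (c • incl p 1) 0 := by
  simpa using (hasCircleDeriv_const c).hasWeakDeriv (p := p)

lemma HasWeakDeriv.sub {u v u' v' : Lp ℂ p (volume : Measure S1)}
    (h : HasWeakDeriv u v) (h' : HasWeakDeriv u' v') : HasWeakDeriv (u - u') (v - v') := by
  simpa [sub_eq_add_neg] using h.add (h'.smul (-1))

lemma HasWeakDeriv.eq_zero {v : Lp ℂ p (volume : Measure S1)} (h : HasWeakDeriv 0 v) : v = 0 := by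
  refine eq_zero_of_pairLp_eq_zero (pairLp_eq_zero_of_smooth fun φ hφ => ?_)
  have h1 : IsCk ((0 + 1 : ℕ) : ℕ∞) φ := hφ.mono le_top
  obtain ⟨φ', hφ', -⟩ := h1.exists_hasCircleDeriv
  have := hasWeakDeriv_iff_pairLp.mp h φ φ' hφ hφ'
  simpa using this.symm

lemma HasWeakDeriv.unique {u v v' : Lp ℂ p (volume : Measure S1)} (h : HasWeakDeriv u v)
    (h' : HasWeakDeriv u v') : v = v' :=
  sub_eq_zero.mp (HasWeakDeriv.eq_zero (by simpa using h.sub h'))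

lemma HasWeakDeriv.meanLp_eq_zero {u v : Lp ℂ p (volume : Measure S1)} (h : HasWeakDeriv u v) :
    meanLp p v = 0 := by
  have h1 := hasWeakDeriv_iff_pairLp.mp h 1 0 (isCk_const ⊤ 1) (by
    simpa using hasCircleDeriv_const 1)
  rw [map_zero] at h1
  exact neg_eq_zero.mp h1.symm

/-- The du Bois-Reymond argument: the test function is the primitive of ψ - ∫ ψ, so that u minus its
mean pairs to zero with every smooth ψ. -/
lemma HasWeakDeriv.eq_const {u : Lp ℂ p (volume : Measure S1)} (h : HasWeakDeriv u 0) :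
    u = meanLp p u • incl p 1 := by
  refine sub_eq_zero.mp (eq_zero_of_pairLp_eq_zero (pairLp_eq_zero_of_smooth fun ψ hψ => ?_))
  have h1 := hasWeakDeriv_iff_pairLp.mp h _ _ (isCk_primC hψ) (hasCircleDeriv_primC ψ)
  have h2 : pairLp p (incl p 1) ψ = meanC ψ := by
    rw [pairLp_incl, meanC_apply]
    simp
  have h3 : pairLp p u 1 = meanLp p u := rfl
  simp only [map_sub, map_smul, map_zero, zero_apply, neg_zero, h3] at h1
  simp only [map_sub, map_smul, sub_apply, smul_apply, h2]
  simp only [smul_eq_mul] at h1 ⊢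
  linear_combination h1

lemma hasWeakDeriv_iff (hp : p ≠ ⊤) {u v : Lp ℂ p (volume : Measure S1)} :
    HasWeakDeriv u v ↔ meanLp p v = 0 ∧ ∃ c : ℂ, u = primLpLp p v + c • incl p 1 := by
  have hP := hasWeakDeriv_primLpLp hp v
  constructor
  · intro h
    have h0 := h.meanLp_eq_zero
    rw [h0, zero_smul, sub_zero] at hP
    have h1 := h.sub hP
    rw [sub_self] at h1
    exact ⟨h0, _, (add_eq_of_eq_sub' h1.eq_const.symm).symm⟩
  · rintro ⟨h, c, rfl⟩
    rw [h, zero_smul, sub_zero] at hP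
    simpa using hP.add (hasWeakDeriv_const c)

/-- `L^p` with the weak derivative. -/
def modelLp (hp : p ≠ ⊤) : CircleModel (Lp ℂ p (volume : Measure S1)) where
  ev u := u
  J := meanLp p
  P := primLpLp p
  one := incl p 1
  J_eq := meanLp_apply
  J_one := by simp [meanLp_incl]
  P_one := by
    have h : primC 1 = 0 := modelC.P_one
    simp [primLpLp, primLp_incl, h]
  ev_const u := by
    have h1 : ∀ c : ℂ, (c • incl p 1 : Lp ℂ p (volume : Measure S1)) =ᵐ[volume] fun _ => c := by
      intro c
      rw [← map_smul]
      filter_upwards [incl_ae (p := p) (c • 1)] with t ht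
      rw [ht]
      simp
    constructor
    · rintro ⟨c, hc⟩
      exact ⟨c, Lp.ext (EventuallyEq.trans hc (h1 c).symm)⟩
    · rintro ⟨c, rfl⟩
      exact ⟨c, h1 c⟩
  eq_zero_of_P v c hv h := by
    have h1 := hasWeakDeriv_primLpLp hp v
    rw [hv, zero_smul, sub_zero, h] at h1
    exact h1.unique (hasWeakDeriv_const c)

lemma modelLp_hasDeriv_iff (hp : p ≠ ⊤) {u v : Lp ℂ p (volume : Measure S1)} :
    (modelLp hp).HasDeriv u v ↔ HasWeakDeriv u v :=
  (hasWeakDeriv_iff hp).symm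

end Weak

/-! ### Lifts of diffeomorphisms -/

/-- Such an f is integer valued, hence constant by connectedness. It controls the ambiguity of
lifts. -/
lemma exists_eq_const_of_coe_eq_zero {f : ℝ → ℝ} (hf : Continuous f)
    (h : ∀ s, (f s : S1) = 0) : ∃ m : ℝ, ∀ s, f s = m := by
  choose g hg using fun s => (AddCircle.coe_eq_zero_iff (1 : ℝ)).mp (h s)
  have hfg : f = (fun n : ℤ => (n : ℝ)) ∘ g := by
    funext s
    simp [← hg s]
  have hgc : Continuous g :=
    Int.isClosedEmbedding_coe_real.isEmbedding.continuous_iff.mpr (hfg ▸ hf)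
  refine ⟨f 0, fun s => ?_⟩
  rw [hfg, Function.comp_apply, Function.comp_apply,
    PreconnectedSpace.constant inferInstance hgc (x := s) (y := 0)]

/-- `ψ` is a continuously differentiable lift to `ℝ` of the map `h` of the circle. -/
structure IsLift (h : S1 → S1) (ψ : ℝ → ℝ) : Prop where
  contDiff : ContDiff ℝ 1 ψ
  coe : ∀ s : ℝ, h (s : S1) = (ψ s : S1)

/-- The difference ψ(s + 1) - ψ(s) is a continuous function with integer values, so it is constant
and disappears on differentiation. -/
lemma IsLift.deriv_periodic {h : S1 → S1} {ψ : ℝ → ℝ} (H : IsLift h ψ) :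
    Function.Periodic (deriv ψ) 1 := by
  obtain ⟨m, hm⟩ := exists_eq_const_of_coe_eq_zero (f := fun s => ψ (s + 1) - ψ s)
    ((H.contDiff.continuous.comp (by fun_prop)).sub H.contDiff.continuous) (fun s => by
      rw [AddCircle.coe_sub, ← H.coe, ← H.coe, AddCircle.coe_add_period, sub_self])
  intro s
  have h1 : (fun s => ψ (s + 1)) = fun s => ψ s + m := by
    funext s
    linarith [hm s]
  rw [← deriv_comp_add_const, h1, deriv_add_const]

lemma IsLift.hasDerivAt {h : S1 → S1} {ψ : ℝ → ℝ} (H : IsLift h ψ) (s : ℝ) :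
    HasDerivAt ψ (deriv ψ s) s :=
  (H.contDiff.differentiable one_ne_zero s).hasDerivAt

section Diffeo

variable {k : ℕ∞}

lemma CircleDiffeo.isLift (φ : CircleDiffeo k) (hk : 1 ≤ k) :
    IsLift φ.toHomeomorph (Classical.choose φ.exists_lift) :=
  ⟨(Classical.choose_spec φ.exists_lift).1.of_le (by exact_mod_cast hk),
    (Classical.choose_spec φ.exists_lift).2⟩

lemma CircleDiffeo.deriv_coe (φ : CircleDiffeo k) (hk : 1 ≤ k) (s : ℝ) :
    φ.deriv (s : S1) = _root_.deriv (Classical.choose φ.exists_lift) s := by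
  have H := (φ.isLift hk).deriv_periodic
  rw [CircleDiffeo.deriv, ← H.lift_coe, AddCircle.coe_equivIco, H.lift_coe]

lemma CircleDiffeo.isCk_deriv {l : ℕ∞} (φ : CircleDiffeo k) (hk : k = l + 1) :
    IsCk l (fun t => (φ.deriv t : ℂ)) := by
  subst hk
  have h1 := (Classical.choose_spec φ.exists_lift).1
  have h2 : ContDiff ℝ ((l : WithTop ℕ∞) + 1) (Classical.choose φ.exists_lift) := by
    exact_mod_cast h1
  unfold IsCk
  simp only [φ.deriv_coe le_add_self]
  exact Complex.ofRealCLM.contDiff.comp (contDiff_succ_iff_deriv.mp h2).2.2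

/-- A `C¹` diffeomorphism distorts the measure by a bounded factor. -/
lemma exists_map_volume_le (h : S1 ≃ₜ S1) {ψ χ : ℝ → ℝ} (hψ : IsLift h ψ) (hχ : IsLift h.symm χ) :
    ∃ C : ℝ≥0∞, C ≠ ⊤ ∧ (volume : Measure S1).map h ≤ C • (volume : Measure S1) := by
  -- The two lifts are inverse to each other up to a translation: x = m + χ(ψ(x)).
  obtain ⟨m, hm⟩ := exists_eq_const_of_coe_eq_zero (f := fun s => s - χ (ψ s))
    (continuous_id.sub (hχ.contDiff.continuous.comp hψ.contDiff.continuous)) (fun s => by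
      rw [AddCircle.coe_sub, ← hχ.coe, ← hψ.coe, h.symm_apply_apply, sub_self])
  obtain ⟨R, hR⟩ := (isCompact_Icc (a := (0 : ℝ)) (b := 1)).exists_bound_of_continuousOn
    hψ.contDiff.continuous.continuousOn
  obtain ⟨N, hN⟩ := exists_nat_gt R
  obtain ⟨K, hK⟩ := LocallyLipschitzOn.exists_lipschitzOnWith_of_compact
    (isCompact_Icc (a := (-N : ℝ)) (b := N)) (hχ.contDiff.locallyLipschitz.locallyLipschitzOn)
  have hK' : LipschitzOnWith K (fun s => m + χ s) (Set.Icc (-N : ℝ) N) := fun x hx y hy => by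
    simpa using hK hx hy
  -- The intervals (n, n + 1] with n in `I` cover [-N, N]; the index -N - 1 is needed for the
  -- endpoint -N.
  let I : Finset ℤ := Finset.Ico (-(N : ℤ) - 1) N
  refine ⟨K * I.card, ENNReal.mul_ne_top ENNReal.coe_ne_top (ENNReal.natCast_ne_top _),
    Measure.le_iff.mpr fun s hs => ?_⟩
  rw [Measure.map_apply h.continuous.measurable hs, Measure.smul_apply, smul_eq_mul]
  let S : Set ℝ := ((↑) : ℝ → S1) ⁻¹' s
  have hsub : (((↑) : ℝ → S1) ⁻¹' (h ⁻¹' s)) ∩ Set.Ioc (0 : ℝ) (0 + 1) ⊆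
      (fun s => m + χ s) '' (S ∩ Set.Icc (-N : ℝ) N) := by
    rintro x ⟨hx, hx0, hx1⟩
    refine ⟨ψ x, ⟨?_, abs_le.mp ((hR x ⟨hx0.le, by simpa using hx1⟩).trans hN.le)⟩, ?_⟩
    · show ((ψ x : ℝ) : S1) ∈ s
      rw [← hψ.coe]
      exact hx
    · have := hm x
      simp only at this ⊢
      linarith
  have hcover : S ∩ Set.Icc (-N : ℝ) N ⊆ ⋃ n ∈ I, S ∩ Set.Ioc (n : ℝ) (n + 1) := by
    rintro x ⟨hx, hx1, hx2⟩
    simp only [Set.mem_iUnion]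
    refine ⟨⌈x⌉ - 1, ?_, hx, ?_, ?_⟩
    · have h1 : -(N : ℤ) ≤ ⌈x⌉ := by
        have : ((-(N : ℤ) : ℤ) : ℝ) ≤ ⌈x⌉ := by
          push_cast
          exact hx1.trans (Int.le_ceil x)
        exact_mod_cast this
      have h2 : ⌈x⌉ ≤ (N : ℤ) := Int.ceil_le.mpr (by exact_mod_cast hx2)
      exact Finset.mem_Ico.mpr ⟨by omega, by omega⟩
    · push_cast
      linarith [Int.ceil_lt_add_one x]
    · push_cast
      linarith [Int.le_ceil x]
  calc volume (h ⁻¹' s)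
      = volume ((((↑) : ℝ → S1) ⁻¹' (h ⁻¹' s)) ∩ Set.Ioc (0 : ℝ) (0 + 1)) :=
        AddCircle.add_projection_respects_measure 1 0 (h.continuous.measurable hs)
    _ ≤ volume ((fun s => m + χ s) '' (S ∩ Set.Icc (-N : ℝ) N)) := measure_mono hsub
    -- On the line Lebesgue measure is one-dimensional Hausdorff measure, which a K-Lipschitz map
    -- enlarges by at most the factor K.
    _ ≤ K * volume (S ∩ Set.Icc (-N : ℝ) N) := by
        rw [← hausdorffMeasure_real]
        simpa using (hK'.mono Set.inter_subset_right).hausdorffMeasure_image_le zero_le_one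
    _ ≤ K * ∑ n ∈ I, volume (S ∩ Set.Ioc (n : ℝ) (n + 1)) := by
        gcongr
        exact (measure_mono hcover).trans (measure_biUnion_finset_le _ _)
    _ = K * I.card * volume s := by
        have : ∀ n : ℤ, volume (S ∩ Set.Ioc (n : ℝ) (n + 1)) = volume s := fun n =>
          (AddCircle.add_projection_respects_measure 1 (n : ℝ) hs).symm
        simp [this, mul_assoc]

end Diffeo

/-! ### Pullback operators -/

/-- `u ↦ c · (u ∘ h)` on continuous functions. -/
def pullC (h : C(S1, S1)) (c : C(S1, ℂ)) : C(S1, ℂ) →L[ℂ] C(S1, ℂ) :=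
  LinearMap.mkContinuous
    { toFun := fun u => c * u.comp h
      map_add' := fun u v => by ext; simp [mul_add]
      map_smul' := fun a u => by ext; simp [mul_left_comm] } ‖c‖ (fun u => by
    refine (ContinuousMap.norm_le _ (by positivity)).mpr fun t => ?_
    show ‖c t * u (h t)‖ ≤ _
    rw [norm_mul]
    gcongr
    · exact c.norm_coe_le_norm t
    · exact u.norm_coe_le_norm _)

@[simp] lemma pullC_apply (h : C(S1, S1)) (c u : C(S1, ℂ)) (t : S1) :
    pullC h c u t = c t * u (h t) := rfl

lemma HasCircleDeriv.mul_comp {h : C(S1, S1)} {ψ : ℝ → ℝ} (hψ : IsLift h ψ) {θ c c' u v : C(S1, ℂ)}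
    (hθ : ∀ s : ℝ, θ (s : S1) = deriv ψ s) (hc : HasCircleDeriv c c') (hu : HasCircleDeriv u v) :
    HasCircleDeriv (pullC h c u) (pullC h c' u + pullC h (c * θ) v) := by
  intro s
  have h1 := (hc s).mul ((hu (ψ s)).scomp s (hψ.hasDerivAt s))
  have e1 : (fun s : ℝ => pullC h c u (s : S1)) =
      (fun s : ℝ => c (s : S1)) * (fun s : ℝ => u (s : S1)) ∘ ψ := by
    funext x
    simp [hψ.coe]
  have e2 : (pullC h c' u + pullC h (c * θ) v) (s : S1) =
      c' (s : S1) * u (ψ s : S1) + c (s : S1) * deriv ψ s • v (ψ s : S1) := by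
    simp only [ContinuousMap.add_apply, pullC_apply, ContinuousMap.mul_apply, hψ.coe, hθ,
      Complex.real_smul]
    ring
  rw [e1, e2]
  exact h1

def pullbackC {h : C(S1, S1)} {ψ : ℝ → ℝ} (hψ : IsLift h ψ) {θ : C(S1, ℂ)}
    (hθ : ∀ s : ℝ, θ (s : S1) = deriv ψ s) : modelC.Pullback h θ where
  T := pullC h
  T_zero u := by ext; simp
  ev_T c u := ae_of_all _ fun t => rfl
  hasDeriv_T hc hu := by
    rw [modelC_hasDeriv_iff] at hu ⊢
    exact hc.mul_comp hψ hθ hu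

section PullLp

variable {p : ℝ≥0∞} {h : C(S1, S1)} {C : ℝ≥0∞}

/-- Preimages of null sets under h are null, so u ∘ h is well defined on classes. -/
lemma ae_comp_of_map_le (hle : (volume : Measure S1).map h ≤ C • volume) {q : S1 → Prop}
    (hq : ∀ᵐ t ∂(volume : Measure S1), q t) : ∀ᵐ t ∂(volume : Measure S1), q (h t) :=
  ae_of_ae_map h.continuous.aemeasurable
    ((Measure.absolutelyContinuous_of_le_smul hle).ae_le hq)

lemma aestronglyMeasurable_map (hle : (volume : Measure S1).map h ≤ C • volume)
    (u : Lp ℂ p (volume : Measure S1)) : AEStronglyMeasurable u ((volume : Measure S1).map h) :=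
  (Lp.aestronglyMeasurable u).mono_ac (Measure.absolutelyContinuous_of_le_smul hle)

/-- The norm of u ∘ h is that of u for the pushforward measure; the bound C on its density enters to
the power 1/p. -/
lemma eLpNorm_mul_comp_le (hle : (volume : Measure S1).map h ≤ C • volume) (c : C(S1, ℂ))
    (u : Lp ℂ p (volume : Measure S1)) :
    eLpNorm (fun t => c t * u (h t)) p volume ≤
      ENNReal.ofReal ‖c‖ * (C ^ (1 / p).toReal * eLpNorm u p volume) := by
  refine (eLpNorm_le_mul_eLpNorm_of_ae_le_mul (g := u ∘ h) (c := ‖c‖) (ae_of_all _ fun t => ?_)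
    p).trans ?_
  · rw [norm_mul]
    exact mul_le_mul_of_nonneg_right (c.norm_coe_le_norm t) (norm_nonneg _)
  · gcongr
    rw [← eLpNorm_map_measure (aestronglyMeasurable_map hle u) h.continuous.aemeasurable]
    exact eLpNorm_le_of_measure_le_smul hle

lemma memLp_mul_comp (hC : C ≠ ⊤) (hle : (volume : Measure S1).map h ≤ C • volume) (c : C(S1, ℂ))
    (u : Lp ℂ p (volume : Measure S1)) : MemLp (fun t => c t * u (h t)) p volume := by
  refine ⟨c.continuous.aestronglyMeasurable.mul
    ((aestronglyMeasurable_map hle u).comp_aemeasurable h.continuous.aemeasurable), ?_⟩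
  refine (eLpNorm_mul_comp_le hle c u).trans_lt ?_
  exact ENNReal.mul_lt_top ENNReal.ofReal_lt_top (ENNReal.mul_lt_top
    (ENNReal.rpow_lt_top_of_nonneg ENNReal.toReal_nonneg hC) (Lp.eLpNorm_lt_top u))

variable [Fact (1 ≤ p)]

/-- `u ↦ c · (u ∘ h)` on `L^p`. -/
def pullLp (hC : C ≠ ⊤) (hle : (volume : Measure S1).map h ≤ C • volume) (c : C(S1, ℂ)) :
    Lp ℂ p (volume : Measure S1) →L[ℂ] Lp ℂ p (volume : Measure S1) :=
  LinearMap.mkContinuous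
    { toFun := fun u => (memLp_mul_comp hC hle c u).toLp _
      map_add' := fun u v => by
        rw [← MemLp.toLp_add, MemLp.toLp_eq_toLp_iff]
        filter_upwards [ae_comp_of_map_le hle (Lp.coeFn_add u v)] with t ht
        show c t * (u + v : Lp ℂ p (volume : Measure S1)) (h t) = c t * u (h t) + c t * v (h t)
        rw [ht, Pi.add_apply, mul_add]
      map_smul' := fun a u => by
        rw [RingHom.id_apply, ← MemLp.toLp_const_smul, MemLp.toLp_eq_toLp_iff]
        filter_upwards [ae_comp_of_map_le hle (Lp.coeFn_smul a u)] with t ht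
        simp [ht, mul_left_comm] } (‖c‖ * (C ^ (1 / p).toReal).toReal) (fun u => by
    have hfin : C ^ (1 / p).toReal ≠ ⊤ :=
      ENNReal.rpow_ne_top_of_nonneg ENNReal.toReal_nonneg hC
    show ‖(memLp_mul_comp hC hle c u).toLp _‖ ≤ _
    rw [Lp.norm_toLp, Lp.norm_def, mul_assoc]
    refine (ENNReal.toReal_mono ?_ (eLpNorm_mul_comp_le hle c u)).trans_eq ?_
    · exact ENNReal.mul_ne_top ENNReal.ofReal_ne_top (ENNReal.mul_ne_top hfin (Lp.eLpNorm_ne_top u))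
    · rw [ENNReal.toReal_mul, ENNReal.toReal_mul, ENNReal.toReal_ofReal (norm_nonneg _)])

lemma pullLp_ae (hC : C ≠ ⊤) (hle : (volume : Measure S1).map h ≤ C • volume) (c : C(S1, ℂ))
    (u : Lp ℂ p (volume : Measure S1)) :
    ∀ᵐ t ∂(volume : Measure S1), pullLp hC hle c u t = c t * u (h t) :=
  (memLp_mul_comp hC hle c u).coeFn_toLp

lemma pullLp_incl (hC : C ≠ ⊤) (hle : (volume : Measure S1).map h ≤ C • volume)
    (c u : C(S1, ℂ)) : pullLp hC hle c (incl p u) = incl p (pullC h c u) := by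
  refine Lp.ext ?_
  filter_upwards [pullLp_ae hC hle c (incl p u), incl_ae (p := p) (pullC h c u),
    ae_comp_of_map_le hle (incl_ae (p := p) u)] with t h1 h2 h3
  rw [h1, h2, h3, pullC_apply]

/-- Density is applied to w rather than to its primitive: approximating w by continuous functions
approximates P w + κ and its derivative simultaneously, and the classical product and chain rules
pass to the limit. -/
lemma hasWeakDeriv_pullLp (hp : p ≠ ⊤) (hC : C ≠ ⊤)
    (hle : (volume : Measure S1).map h ≤ C • volume) {ψ : ℝ → ℝ} (hψ : IsLift h ψ)
    {θ c c' : C(S1, ℂ)} (hθ : ∀ s : ℝ, θ (s : S1) = deriv ψ s) (hc : HasCircleDeriv c c')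
    (κ : ℂ) (w : Lp ℂ p (volume : Measure S1)) :
    HasWeakDeriv (pullLp hC hle c (primLpLp p w + κ • incl p 1))
      (pullLp hC hle c' (primLpLp p w + κ • incl p 1) +
        pullLp hC hle (c * θ) (w - meanLp p w • incl p 1)) := by
  have hcont : Continuous fun w : Lp ℂ p (volume : Measure S1) =>
      primLpLp p w + κ • incl p 1 := (primLpLp p).continuous.add continuous_const
  refine (ContinuousMap.toLp_denseRange ℂ (volume : Measure S1) ℂ hp).induction_on w
    (isClosed_hasWeakDeriv ((pullLp hC hle c).continuous.comp hcont)
      (((pullLp hC hle c').continuous.comp hcont).add ((pullLp hC hle (c * θ)).continuous.comp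
        (continuous_id.sub ((meanLp p).continuous.smul continuous_const))))) fun g => ?_
  have h1 := ((hc.mul_comp hψ hθ ((hasCircleDeriv_primC g).add_const κ))).hasWeakDeriv (p := p)
  rw [map_add (incl p), ← pullLp_incl hC hle, ← pullLp_incl hC hle, ← pullLp_incl hC hle,
    map_add (incl p), map_sub (incl p), map_smul (incl p), map_smul (incl p), meanC_apply,
    ← meanLp_incl (p := p), ← primLp_incl (p := p)] at h1
  exact h1

def pullbackLp (hp : p ≠ ⊤) (hC : C ≠ ⊤) (hle : (volume : Measure S1).map h ≤ C • volume)
    {ψ : ℝ → ℝ} (hψ : IsLift h ψ) {θ : C(S1, ℂ)} (hθ : ∀ s : ℝ, θ (s : S1) = deriv ψ s) :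
    (modelLp (p := p) hp).Pullback h θ where
  T := pullLp hC hle
  T_zero u := by
    refine Lp.ext ?_
    filter_upwards [pullLp_ae hC hle 0 u, Lp.coeFn_zero ℂ p (volume : Measure S1)] with t h1 h2
    rw [h1, h2]
    simp
  ev_T := pullLp_ae hC hle
  hasDeriv_T {c c' u v} hc hu := by
    rw [modelLp_hasDeriv_iff]
    obtain ⟨h0, κ, rfl⟩ := hu
    have h1 := hasWeakDeriv_pullLp hp hC hle hψ hθ hc κ v
    have h0' : meanLp p v = 0 := h0
    rw [h0', zero_smul, sub_zero] at h1
    exact h1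

end PullLp

/-! ### Pullback operators of a diffeomorphism in the two models -/

lemma CircleDiffeo.exists_pullbackC {l k : ℕ∞} (hk : k = l + 1) (φ : CircleDiffeo k) :
    ∃ θ : C(S1, ℂ), (∀ t, θ t = φ.deriv t) ∧ IsCk l θ ∧
      Nonempty (modelC.Pullback φ.toHomeomorph θ) := by
  have hk1 : 1 ≤ k := hk ▸ le_add_self
  have hθ := φ.isCk_deriv hk
  exact ⟨⟨_, hθ.continuous⟩, fun _ => rfl, hθ,
    ⟨pullbackC (h := ⟨φ.toHomeomorph, φ.toHomeomorph.continuous⟩) (φ.isLift hk1)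
      fun s => congrArg Complex.ofReal (φ.deriv_coe hk1 s)⟩⟩

lemma CircleDiffeo.exists_pullbackLp {p : ℝ≥0∞} [Fact (1 ≤ p)] (hp : p ≠ ⊤) {l k : ℕ∞}
    (hk : k = l + 1) (φ : CircleDiffeo k) :
    ∃ θ : C(S1, ℂ), (∀ t, θ t = φ.deriv t) ∧ IsCk l θ ∧
      Nonempty ((modelLp (p := p) hp).Pullback φ.toHomeomorph θ) := by
  have hk1 : 1 ≤ k := hk ▸ le_add_self
  have hθ := φ.isCk_deriv hk
  obtain ⟨χ, hχ, hχ'⟩ := φ.exists_lift_symm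
  obtain ⟨C, hC, hle⟩ := exists_map_volume_le φ.toHomeomorph (φ.isLift hk1)
    ⟨hχ.of_le (by exact_mod_cast hk1), hχ'⟩
  exact ⟨⟨_, hθ.continuous⟩, fun _ => rfl, hθ,
    ⟨pullbackLp (h := ⟨φ.toHomeomorph, φ.toHomeomorph.continuous⟩) hp hC hle (φ.isLift hk1)
      fun s => congrArg Complex.ofReal (φ.deriv_coe hk1 s)⟩⟩

/-! ### The spaces `C^l` and `W^{l,p}` as spaces of functions with `l` derivatives -/

namespace CircleModel

variable {E : Type} [NormedAddCommGroup E] [NormedSpace ℂ E] {M : CircleModel E}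
  {X : Type} [TopologicalSpace X]

/-- By uniqueness, a known chain of derivatives replaces the existential witnesses of `IsJet`,
leaving the continuity of each member. This matches the induced topologies of `Ck` and `Sob`. -/
lemma isJet_iff_of_chain {n : ℕ} : ∀ {w : ℕ → X → E},
    (∀ j < n, ∀ x, M.HasDeriv (w j x) (w (j + 1) x)) →
    (M.IsJet n (w 0) ↔ ∀ j ≤ n, Continuous (w j)) := by
  induction n with
  | zero =>
    intro w _
    refine ⟨fun h j hj => ?_, fun h => h 0 le_rfl⟩
    rw [Nat.le_zero.mp hj]
    exact h
  | succ n ih =>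
    intro w hw
    have ih' := ih (w := fun j => w (j + 1)) fun j hj => hw (j + 1) (by omega)
    refine ⟨fun h j hj => ?_, fun h => ⟨h 0 (by omega), w 1, hw 0 (by omega),
      ih'.mpr fun j hj => h (j + 1) (by omega)⟩⟩
    cases j with
    | zero => exact h.continuous
    | succ j => exact ih'.mp (h.deriv (hw 0 (by omega))) j (by omega)

lemma IsJet.exists_chain {n : ℕ} : ∀ {u : X → E}, M.IsJet n u →
    ∃ w : ℕ → X → E, w 0 = u ∧ ∀ j < n, ∀ x, M.HasDeriv (w j x) (w (j + 1) x) := by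
  induction n with
  | zero => exact fun {u} _ => ⟨fun _ => u, rfl, fun j hj => by omega⟩
  | succ n ih =>
    rintro u ⟨-, v, huv, hv⟩
    obtain ⟨w, rfl, hw⟩ := ih hv
    refine ⟨fun j => Nat.casesOn j u w, rfl, fun j hj => ?_⟩
    cases j with
    | zero => exact huv
    | succ j => exact hw j (by omega)

end CircleModel

lemma HasCircleDeriv.isCk_succ {u v : C(S1, ℂ)} (h : HasCircleDeriv u v) {n : ℕ} (hv : IsCk n v) :
    IsCk (n + 1 : ℕ) u := by
  have hd : deriv (fun s : ℝ => u (s : S1)) = fun s : ℝ => v (s : S1) :=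
    funext fun s => (h s).deriv
  have : ContDiff ℝ ((n : WithTop ℕ∞) + 1) (fun s : ℝ => u (s : S1)) := by
    refine contDiff_succ_iff_deriv.mpr ⟨fun s => (h s).differentiableAt, by simp, ?_⟩
    rw [hd]
    exact hv
  exact_mod_cast this

lemma modelC_isJet_isCk {X : Type} [TopologicalSpace X] {n : ℕ} :
    ∀ {u : X → C(S1, ℂ)}, modelC.IsJet n u → ∀ x, IsCk n (u x) := by
  induction n with
  | zero =>
    intro u _ x
    exact contDiff_zero.mpr (continuous_coe (u x))
  | succ n ih =>
    rintro u ⟨-, v, huv, hv⟩ x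
    exact (modelC_hasDeriv_iff.mp (huv x)).isCk_succ (ih hv x)

lemma isCk_of_forall_nat {l : ℕ∞} {f : S1 → ℂ} (h : ∀ n : ℕ, (n : ℕ∞) ≤ l → IsCk n f) :
    IsCk l f :=
  contDiff_iff_forall_nat_le.mpr h

/-- The inclusion of `C^l` into the continuous functions. -/
def Ck.toC {l : ℕ∞} : Ck l →ₗ[ℂ] C(S1, ℂ) where
  toFun x := x.iterDeriv 0 (by simp)
  map_add' _ _ := rfl
  map_smul' _ _ := rfl

lemma Ck.hasCircleDeriv_iterDeriv {l : ℕ∞} (x : Ck l) {j : ℕ} (hj : ((j + 1 : ℕ) : ℕ∞) ≤ l)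
    (hj' : (j : ℕ∞) ≤ l) : HasCircleDeriv (x.iterDeriv j hj') (x.iterDeriv (j + 1) hj) := by
  intro s
  have hx : ContDiff ℝ (l : WithTop ℕ∞) (fun s : ℝ => x.fn (s : S1)) := x.2
  have hd : Differentiable ℝ (iteratedDeriv j fun s : ℝ => x.fn (s : S1)) :=
    hx.differentiable_iteratedDeriv j (by
      have : ((j : ℕ) : ℕ∞) < l := lt_of_lt_of_le (by exact_mod_cast Nat.lt_succ_self j) hj
      exact_mod_cast this)
  have h := (hd s).hasDerivAt
  rw [← iteratedDeriv_succ, ← circleDeriv_iterate_coe, ← circleDeriv_iterate_coe] at h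
  exact h

lemma Ck.hasCircleDeriv_dot {l : ℕ∞} (y : Ck (l + 1)) : HasCircleDeriv y.toC y.dot.toC :=
  y.hasCircleDeriv_iterDeriv (j := 0) (by simp) (by simp)

open Classical in
lemma Ck.realizes (l : ℕ∞) : modelC.Realizes l (Ck.fn (l := l)) Ck.toC where
  injective x y h := Subtype.ext (congrArg DFunLike.coe h)
  eq_ev _ := rfl
  exists_of_isJet u hu :=
    ⟨⟨u, isCk_of_forall_nat fun n hn => modelC_isJet_isCk (hu n hn) ()⟩, rfl⟩
  continuous_iff {X} _ T := by
    -- The value 0 beyond order l is a filler; only indices j ≤ l are ever used.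
    let w : ℕ → X → C(S1, ℂ) := fun j x =>
      if hj : (j : ℕ∞) ≤ l then (T x).iterDeriv j hj else 0
    have hw : ∀ {j : ℕ} (hj : (j : ℕ∞) ≤ l), w j = fun x => (T x).iterDeriv j hj := fun hj => by
      funext x
      simp only [w, dif_pos hj]
    have hchain : ∀ n : ℕ, (n : ℕ∞) ≤ l → ∀ j < n, ∀ x,
        modelC.HasDeriv (w j x) (w (j + 1) x) := by
      intro n hn j hj x
      have h1 : ((j + 1 : ℕ) : ℕ∞) ≤ l := le_trans (by exact_mod_cast hj) hn
      have h0 : (j : ℕ∞) ≤ l := le_trans (by exact_mod_cast Nat.le_succ j) h1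
      rw [hw h0, hw h1, modelC_hasDeriv_iff]
      exact (T x).hasCircleDeriv_iterDeriv h1 h0
    have hjet : ∀ n : ℕ, (n : ℕ∞) ≤ l →
        (modelC.IsJet n (fun x => (T x).toC) ↔ ∀ j ≤ n, Continuous (w j)) := fun n hn => by
      rw [← CircleModel.isJet_iff_of_chain (hchain n hn), hw (j := 0) (by simp)]
      rfl
    rw [continuous_induced_rng, continuous_pi_iff]
    constructor
    · intro h n hn
      refine (hjet n hn).mpr fun j hj => ?_
      have hjl : (j : ℕ∞) ≤ l := le_trans (by exact_mod_cast hj) hn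
      rw [hw hjl]
      exact h ⟨j, hjl⟩
    · rintro h ⟨j, hj⟩
      have := (hjet j hj).mp (h j hj) j le_rfl
      rwa [hw hj] at this

section Sob

variable {l : ℕ} {p : ℝ≥0∞} [Fact (1 ≤ p)]

/-- The inclusion of `W^{l,p}` into `L^p`. -/
def Sob.toLp : Sob l p →ₗ[ℂ] Lp ℂ p (volume : Measure S1) := (sobolevSubmodule l p).subtype

lemma Sob.realizes (hp : p ≠ ⊤) :
    (modelLp (p := p) hp).Realizes l (Sob.fn (l := l) (p := p)) Sob.toLp where
  injective := Subtype.val_injective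
  eq_ev _ := rfl
  exists_of_isJet u hu := by
    -- A jet over a one-point parameter space is just a chain of weak derivatives up to order l.
    obtain ⟨w, hw0, hw⟩ := (hu l le_rfl).exists_chain
    exact ⟨⟨u, fun j => w j (), congrFun hw0 (), fun j hj =>
      (modelLp_hasDeriv_iff hp).mp (hw j hj ())⟩, rfl⟩
  continuous_iff {X} _ T := by
    have hw0 : (fun x => (T x).weakDeriv 0) = fun x => (T x).toLp :=
      funext fun x => (T x).weakDeriv_spec.1
    have hjet : ∀ n : ℕ, n ≤ l → ((modelLp (p := p) hp).IsJet n (fun x => (T x).toLp) ↔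
        ∀ j ≤ n, Continuous fun x => (T x).weakDeriv j) := fun n hn => by
      rw [← hw0]
      exact CircleModel.isJet_iff_of_chain (w := fun j x => (T x).weakDeriv j) fun j hj x =>
        (modelLp_hasDeriv_iff hp).mpr ((T x).weakDeriv_spec.2 j (by omega))
    rw [continuous_induced_rng, continuous_pi_iff]
    constructor
    · intro h n hn
      have hn' : n ≤ l := by exact_mod_cast hn
      exact (hjet n hn').mpr fun j hj => h ⟨j, by omega⟩
    · intro h j
      exact (hjet l le_rfl).mp (h l le_rfl) j (by omega)

lemma Sob.hasWeakDeriv_dot (y : Sob (l + 1) p) : HasWeakDeriv y.toLp y.dot.toLp := by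
  have h := y.weakDeriv_spec.2 0 (by omega)
  rwa [y.weakDeriv_spec.1] at h

end Sob

end LoopSpace

end

/-! ### The theorem for both regularity scales -/

open LoopSpace in
theorem theorem2p1 :
    -- loops of class `C^k`, `k = l + 1 = 1, 2, …, ∞`
    (∀ l : ℕ∞,
      (∀ F ∈ FSpace (Ck.fn (l := l + 1)), F ∈ FHom (Ck.fn (l := l + 1)) 0 ↔ IsGFixed F) ∧
      Module.finrank ℂ (integralLine (Ck.fn (l := l))) = 1 ∧
      ∃ e : ((Ck l →L_c[ℂ] ℂ) ⧸ integralLine (Ck.fn (l := l)))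
          ≃L[ℂ] FHom (Ck.fn (l := l + 1)) 0,
        (∀ (Φ : Ck l →L_c[ℂ] ℂ) (ζ : ℂ) (y : Ck (l + 1)),
          (e (Submodule.Quotient.mk Φ)).1 (ζ, y) = Φ y.dot) ∧
        ∀ φ : CircleDiffeo (l + 1),
          ∃ (A : Ck (l + 1) →L[ℂ] Ck (l + 1)) (B : Ck l →L[ℂ] Ck l),
            IsFunctionPullback φ Ck.fn A ∧ IsFormPullback φ Ck.fn B ∧
            ∀ Φ Ψ : Ck l →L_c[ℂ] ℂ, (∀ x, Ψ x = Φ (B x)) → ∀ (ζ : ℂ) (y : Ck (l + 1)),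
              (e (Submodule.Quotient.mk Ψ)).1 (ζ, y) = (e (Submodule.Quotient.mk Φ)).1 (ζ, A y)) ∧
    -- loops of class `W^{k,p}`, `k = l + 1 = 1, 2, …`, `1 ≤ p < ∞`
    (∀ (l : ℕ) (p : ℝ≥0∞) [Fact (1 ≤ p)], p ≠ ⊤ →
      (∀ F ∈ FSpace (Sob.fn (l := l + 1) (p := p)),
        F ∈ FHom (Sob.fn (l := l + 1) (p := p)) 0 ↔ IsGFixed F) ∧
      Module.finrank ℂ (integralLine (Sob.fn (l := l) (p := p))) = 1 ∧
      ∃ e : ((Sob l p →L_c[ℂ] ℂ) ⧸ integralLine (Sob.fn (l := l) (p := p)))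
          ≃L[ℂ] FHom (Sob.fn (l := l + 1) (p := p)) 0,
        (∀ (Φ : Sob l p →L_c[ℂ] ℂ) (ζ : ℂ) (y : Sob (l + 1) p),
          (e (Submodule.Quotient.mk Φ)).1 (ζ, y) = Φ y.dot) ∧
        ∀ φ : CircleDiffeo ((l + 1 : ℕ) : ℕ∞),
          ∃ (A : Sob (l + 1) p →L[ℂ] Sob (l + 1) p) (B : Sob l p →L[ℂ] Sob l p),
            IsFunctionPullback φ Sob.fn A ∧ IsFormPullback φ Sob.fn B ∧
            ∀ Φ Ψ : Sob l p →L_c[ℂ] ℂ, (∀ x, Ψ x = Φ (B x)) → ∀ (ζ : ℂ) (y : Sob (l + 1) p),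
              (e (Submodule.Quotient.mk Ψ)).1 (ζ, y) =
                (e (Submodule.Quotient.mk Φ)).1 (ζ, A y)) := by
  refine ⟨fun l => ?_, fun l p _ hp => ?_⟩
  · exact CircleModel.exists_equivariant_equiv (Ck.realizes (l + 1)) (Ck.realizes l) Ck.dot
      (fun y => modelC_hasDeriv_iff.mpr y.hasCircleDeriv_dot)
      (CircleDiffeo.exists_pullbackC rfl)
  · have hV := Sob.realizes (l := l + 1) hp
    rw [Nat.cast_succ] at hV
    exact CircleModel.exists_equivariant_equiv hV (Sob.realizes hp) Sob.dot
      (fun y => (modelLp_hasDeriv_iff hp).mpr y.hasWeakDeriv_dot)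
      (CircleDiffeo.exists_pullbackLp hp (Nat.cast_succ l))
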